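/- Let $\nu\ge 1$ be an integer and let $\mathcal A$ be the Fermion (CAR) $C^*$-algebra of the lattice $\mathbb Z^\nu$: the unital $C^*$-algebra generated by elements $a_i$, $i\in\mathbb Z^\nu$, with $a_i^*a_j+a_ja_i^*=\delta_{ij}\mathbf 1$ and $a_ia_j+a_ja_i=0$. For $I\subset\mathbb Z^\nu$ let $\mathcal A(I)$ be the $C^*$-subalgebra generated by $a_i,a_i^*$, $i\in I$ (with $\mathcal A(\emptyset)=\mathbb C\mathbf 1$). Let $\tau$ be the tracial state of $\mathcal A$, let $E_J:\mathcal A\to\mathcal A(J)$ be the conditional expectation determined by $\tau(ab)=\tau(E_J(a)b)$ for all $b\in\mathcal A(J)$, let $\Theta$ be the automorphism of $\mathcal A$ with $\Theta(a_i)=-a_i$, and for $k\in\mathbb Z^\nu$ let $\tau_k$ be the automorphism with $\tau_k(a_i)=a_{i+k}$. A translation-covariant standard potential is a map $\Phi$ assigning to each finite $I\subset\mathbb Z^\nu$ an element $\Phi(I)\in\mathcal A(I)$ such that * $\Phi(\emptyset)=0$, $\Phi(I)^*=\Phi(I)$ and $\Theta(\Phi(I))=\Phi(I)$; * $E_J(\Phi(I))=0$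 for every $J\subsetneq I$; * for each finite $I$, the net $J\mapsto\sum\{\Phi(K): K\cap I\neq\emptyset,\ K\subset J\}$, indexed by the finite subsets $J$ of $\mathbb Z^\nu$ directed by inclusion, is Cauchy in norm; its limit is denoted $H_\Phi(I)$; * $\tau_k(\Phi(I))=\Phi(I+k)$ for all finite $I$ and all $k\in\mathbb Z^\nu$. Let $P_\tau$ be the real vector space of all such $\Phi$, with pointwise operations. Say that $\Phi\in P_\tau$ has finite range if there is $r\ge 0$ such that $\Phi(I)=0$ whenever $\operatorname{diam}(I)=\max\{|i-j|: i,j\in I\}>r$. Then, for every $\Phi\in P_\tau$, the number $\|\Phi\|:=\|H_\Phi(\{n\})\|$ does not depend on $n\in\mathbb Z^\nu$; $\|\cdot\|$ is a norm on $P_\tau$, and $P_\tau$ is a real Banach space for it; the finite-range potentials form a dense subspace of $P_\tau$; and $P_\tau$ is separable. -/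

import Mathlib

/-!
The Fermion (CAR) C*-algebra of the lattice `ℤ^ν` is realized concretely: the Clifford algebra with
two self-adjoint generators per lattice site acts by left multiplication on the Hilbert space with
orthonormal basis `e_S = γ_S`, `S` a finite set of generators, and the annihilation operators are
`a_i = (γ_{i,0} + i γ_{i,1}) / 2`. The CAR and the generation property, which determine the
algebra up to isomorphism, are `car`, `car_star` and `localAlgebra_univ`.
-/

namespace FermionLattice

open Filter Topology
open scoped lp ENNReal symmDiff InnerProductSpace

noncomputable section

section SignedPermutation

variable {ι : Type*}

/-- The Hilbert space `ℓ²(ι)`. -/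
abbrev L2 (ι : Type*) : Type _ := ℓ²(ι, ℂ)

/- Instance short-cuts. -/

instance : CStarAlgebra (L2 ι →L[ℂ] L2 ι) := inferInstance
instance : Ring (L2 ι →L[ℂ] L2 ι) := inferInstance
instance : Algebra ℂ (L2 ι →L[ℂ] L2 ι) := inferInstance
instance : Module ℂ (L2 ι →L[ℂ] L2 ι) := inferInstance
instance : AddCommGroup (L2 ι →L[ℂ] L2 ι) := inferInstance
instance : StarRing (L2 ι →L[ℂ] L2 ι) := inferInstance
instance : StarModule ℂ (L2 ι →L[ℂ] L2 ι) := inferInstance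
instance : ContinuousStar (L2 ι →L[ℂ] L2 ι) := inferInstance
instance : IsTopologicalRing (L2 ι →L[ℂ] L2 ι) := inferInstance
instance : Semiring (L2 ι →L[ℂ] L2 ι) := inferInstance
instance : NonUnitalNonAssocSemiring (L2 ι →L[ℂ] L2 ι) := inferInstance
instance : AddCommMonoid (L2 ι →L[ℂ] L2 ι) := inferInstance
instance : TopologicalSpace (L2 ι →L[ℂ] L2 ι) := inferInstance
instance : AddZeroClass (L2 ι →L[ℂ] L2 ι) := inferInstance

/-- The standard basis vector `e_s` of `ℓ²(ι)`. -/
def ket (s : ι) : L2 ι :=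
  haveI := Classical.decEq ι
  lp.single 2 s 1

open Classical in
theorem ket_apply (s t : ι) : ket s t = if t = s then 1 else 0 := by
  unfold ket
  rw [lp.single_apply, Pi.single_apply]

theorem inner_ket_left (s : ι) (f : L2 ι) : ⟪ket s, f⟫_ℂ = f s := by
  classical
  rw [ket, lp.inner_single_left]
  simp

theorem ext_ket {A B : L2 ι →L[ℂ] L2 ι} (h : ∀ s, A (ket s) = B (ket s)) : A = B := by
  classical
  refine lp.ext_continuousLinearMap (by norm_num) fun s => ?_
  ext1
  have := h s
  unfold ket at this
  simp only [ContinuousLinearMap.coe_comp, Function.comp_apply, lp.singleContinuousLinearMap_apply]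
  convert this

theorem memℓp_signedPerm (σ : Equiv.Perm ι) (n : ι → ℕ) (f : L2 ι) :
    Memℓp (fun t => (-1 : ℂ) ^ n (σ.symm t) * f (σ.symm t)) 2 := by
  have h := (lp.memℓp f).summable (by norm_num)
  refine memℓp_gen ?_
  simpa [norm_mul, Function.comp_def] using (σ.symm.summable_iff).mpr h

/-- The linear isometry of `ℓ²(ι)` with `e_s ↦ (-1)^(n s) e_{σ s}`. -/
def signedPermIsometry (σ : Equiv.Perm ι) (n : ι → ℕ) : L2 ι →ₗᵢ[ℂ] L2 ι where
  toFun f := ⟨_, memℓp_signedPerm σ n f⟩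
  map_add' f g := by
    ext t
    exact mul_add _ _ _
  map_smul' c f := by ext t; simp; ring
  norm_map' f := by
    rw [lp.norm_eq_tsum_rpow (by norm_num), lp.norm_eq_tsum_rpow (by norm_num)]
    congr 1
    simpa [norm_mul] using σ.symm.tsum_eq (fun t => ‖f t‖ ^ (2 : ℝ))

theorem signedPermIsometry_apply (σ : Equiv.Perm ι) (n : ι → ℕ) (f : L2 ι) (t : ι) :
    signedPermIsometry σ n f t = (-1 : ℂ) ^ n (σ.symm t) * f (σ.symm t) := rfl

/-- The unitary operator on `ℓ²(ι)` with `e_s ↦ (-1)^(n s) e_{σ s}`. -/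
def signedPerm (σ : Equiv.Perm ι) (n : ι → ℕ) : L2 ι ≃ₗᵢ[ℂ] L2 ι :=
  LinearIsometryEquiv.ofSurjective (signedPermIsometry σ n) fun f =>
    ⟨signedPermIsometry σ.symm (n ∘ σ.symm) f, by
      ext t; simp [signedPermIsometry_apply, ← mul_assoc, ← pow_add]⟩

theorem signedPerm_apply (σ : Equiv.Perm ι) (n : ι → ℕ) (f : L2 ι) (t : ι) :
    signedPerm σ n f t = (-1 : ℂ) ^ n (σ.symm t) * f (σ.symm t) := rfl

theorem signedPerm_ket (σ : Equiv.Perm ι) (n : ι → ℕ) (s : ι) :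
    signedPerm σ n (ket s) = (-1 : ℂ) ^ n s • ket (σ s) := by
  classical
  ext t
  rw [signedPerm_apply, lp.coeFn_smul, Pi.smul_apply, ket_apply, ket_apply, smul_eq_mul]
  by_cases h : t = σ s
  · subst h; simp
  · have : σ.symm t ≠ s := fun h' => h (by simp [← h'])
    simp [h, this]

end SignedPermutation

section Clifford

variable {X : Type*} [LinearOrder X]

/-- The permutation `S ↦ S ∆ {x}` of the finite subsets of `X`. -/
def toggle (x : X) : Equiv.Perm (Finset X) :=
  (symmDiff_left_involutive ({x} : Finset X)).toPerm

theorem toggle_apply (x : X) (S : Finset X) : toggle x S = S ∆ {x} := rfl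

/-- Left multiplication by the Clifford generator `γ_x`:
`γ_x e_S = (-1)^#{y ∈ S | y < x} e_{S ∆ {x}}`. -/
def leftGamma (x : X) : L2 (Finset X) →L[ℂ] L2 (Finset X) :=
  (signedPerm (toggle x) fun S => (S.filter (· < x)).card).toContinuousLinearEquiv

/-- Right multiplication by the Clifford generator `γ_x`:
`e_S γ_x = (-1)^#{y ∈ S | x < y} e_{S ∆ {x}}`. -/
def rightGamma (x : X) : L2 (Finset X) →L[ℂ] L2 (Finset X) :=
  (signedPerm (toggle x) fun S => (S.filter (x < ·)).card).toContinuousLinearEquiv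

theorem leftGamma_ket (x : X) (S : Finset X) :
    leftGamma x (ket S) = (-1 : ℂ) ^ (S.filter (· < x)).card • ket (S ∆ {x}) :=
  signedPerm_ket _ _ _

theorem rightGamma_ket (x : X) (S : Finset X) :
    rightGamma x (ket S) = (-1 : ℂ) ^ (S.filter (x < ·)).card • ket (S ∆ {x}) :=
  signedPerm_ket _ _ _

theorem sign_filter_symmDiff (p : X → Prop) [DecidablePred p] (S : Finset X) (x : X) :
    (-1 : ℂ) ^ ((S ∆ {x}).filter p).card =
      (if p x then -1 else 1) * (-1 : ℂ) ^ (S.filter p).card := by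
  by_cases hx : x ∈ S
  · obtain ⟨T, hT, rfl⟩ : ∃ T, x ∉ T ∧ S = insert x T :=
      ⟨S.erase x, by simp, by simp [hx]⟩
    have : (insert x T) ∆ {x} = T := by
      ext z; by_cases hz : z = x <;> simp [Finset.mem_symmDiff, hz, hT]
    rw [this, Finset.filter_insert]
    split_ifs with h
    · rw [Finset.card_insert_of_notMem (by simp [hT]), pow_succ]; ring
    · simp
  · have : S ∆ {x} = insert x S := by
      ext z; by_cases hz : z = x <;> simp [Finset.mem_symmDiff, hz, hx]
    rw [this, Finset.filter_insert]
    split_ifs with h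
    · rw [Finset.card_insert_of_notMem (by simp [hx]), pow_succ]; ring
    · simp

theorem leftGamma_mul_self (x : X) : leftGamma x * leftGamma x = 1 := by
  refine ext_ket fun S => ?_
  rw [mul_apply_eq_comp, leftGamma_ket, map_smul, leftGamma_ket,
    sign_filter_symmDiff, smul_smul, symmDiff_symmDiff_cancel_right]
  simp [← pow_add]

theorem leftGamma_anticomm {x y : X} (h : x ≠ y) :
    leftGamma x * leftGamma y + leftGamma y * leftGamma x = 0 := by
  refine ext_ket fun S => ?_
  rw [add_apply, mul_apply_eq_comp,
    mul_apply_eq_comp, leftGamma_ket, map_smul, leftGamma_ket, leftGamma_ket,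
    map_smul, leftGamma_ket, sign_filter_symmDiff, sign_filter_symmDiff, smul_smul, smul_smul,
    symmDiff_right_comm S {y} {x}, ← add_smul]
  rcases lt_or_gt_of_ne h with h' | h' <;> simp [h', h'.not_gt] <;> left <;> ring

theorem leftGamma_rightGamma_comm (x y : X) :
    leftGamma x * rightGamma y = rightGamma y * leftGamma x := by
  refine ext_ket fun S => ?_
  rw [mul_apply_eq_comp,
    mul_apply_eq_comp, leftGamma_ket, map_smul, rightGamma_ket, rightGamma_ket,
    map_smul, leftGamma_ket, sign_filter_symmDiff, sign_filter_symmDiff, smul_smul, smul_smul,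
    symmDiff_right_comm S {y} {x}]
  congr 1
  split_ifs <;> ring

theorem star_leftGamma (x : X) : star (leftGamma x) = leftGamma x := by
  have h1 : star (leftGamma x) * leftGamma x = 1 := by
    rw [leftGamma, ContinuousLinearMap.star_eq_adjoint]
    erw [LinearIsometryEquiv.adjoint_eq_symm]
    ext1 f
    exact LinearIsometryEquiv.symm_apply_apply _ f
  calc star (leftGamma x) = star (leftGamma x) * (leftGamma x * leftGamma x) := by
        rw [leftGamma_mul_self, mul_one]
    _ = leftGamma x := by rw [← mul_assoc, h1, one_mul]

/-- The ordered product `γ_S = γ_{x₁} ⋯ γ_{xₘ}`, where `S = {x₁ < ⋯ < xₘ}`. -/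
def orderedProd {M : Type*} [Monoid M] (g : X → M) (S : Finset X) : M := ((S.sort).map g).prod

theorem leftGamma_prod_vacuum (S : Finset X) :
    orderedProd leftGamma S (ket ∅) = ket S := by
  induction S using Finset.induction_on_min with
  | empty => simp [orderedProd]
  | insert a s ha ih =>
    have h2 : a ∉ s := fun h => lt_irrefl _ (ha a h)
    have hs : insert a s = s ∆ {a} := by
      ext z; by_cases hz : z = a <;> simp [Finset.mem_symmDiff, hz, h2]
    rw [orderedProd, Finset.sort_insert _ (fun b hb => (ha b hb).le) h2, List.map_cons,
      List.prod_cons, mul_apply_eq_comp]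
    change leftGamma a (orderedProd leftGamma s (ket ∅)) = _
    rw [ih, leftGamma_ket, Finset.filter_eq_empty_iff.mpr fun b hb => (ha b hb).not_gt, ← hs]
    simp

theorem rightGamma_cyclic (S : Finset X) :
    ∃ R ∈ Submonoid.closure (Set.range (rightGamma (X := X))), R (ket ∅) = ket S := by
  induction S using Finset.induction_on_max with
  | empty => exact ⟨1, one_mem _, rfl⟩
  | insert a s ha ih =>
    have h2 : a ∉ s := fun h => lt_irrefl _ (ha a h)
    have hs : insert a s = s ∆ {a} := by
      ext z; by_cases hz : z = a <;> simp [Finset.mem_symmDiff, hz, h2]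
    obtain ⟨R, hR, h⟩ := ih
    refine ⟨rightGamma a * R, mul_mem (Submonoid.subset_closure ⟨a, rfl⟩) hR, ?_⟩
    rw [mul_apply_eq_comp, h, rightGamma_ket,
      Finset.filter_eq_empty_iff.mpr fun b hb => (ha b hb).not_gt, ← hs]
    simp

end Clifford

section FermionAlgebra

variable {ν : ℕ}

/-- The lattice `ℤ^ν`. -/
abbrev Site (ν : ℕ) : Type := Fin ν → ℤ

/-- The index set `ℤ^ν × {0, 1}` of the Clifford generators (two for each lattice site), ordered
lexicographically; this order is invariant under lattice translations. -/
abbrev Mode (ν : ℕ) : Type := Lex (Site ν) ×ₗ Bool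

/-- The mode `(i, b)`. -/
def mode (i : Site ν) (b : Bool) : Mode ν := toLex (toLex i, b)

/-- The Hilbert space on which the Fermion algebra is realized (the GNS space of its tracial
state). -/
abbrev FermionSpace (ν : ℕ) : Type := L2 (Finset (Mode ν))

/-- The vacuum vector `e_∅`. -/
abbrev vacuum (ν : ℕ) : FermionSpace ν := ket ∅

/-- The annihilation operator `a_i = (γ_{i,0} + i γ_{i,1}) / 2`. -/
def annihilationOp (i : Site ν) : FermionSpace ν →L[ℂ] FermionSpace ν :=
  (1 / 2 : ℂ) • (leftGamma (mode i false) + Complex.I • leftGamma (mode i true))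

/-- The C*-algebra generated by the annihilation and creation operators, as a C*-subalgebra of the
bounded operators. -/
def fermionSubalgebra (ν : ℕ) : StarSubalgebra ℂ (FermionSpace ν →L[ℂ] FermionSpace ν) :=
  (StarAlgebra.adjoin ℂ (Set.range annihilationOp)).topologicalClosure

/-- The Fermion (CAR) C*-algebra `𝓐` of the lattice `ℤ^ν`. -/
abbrev FermionAlgebra (ν : ℕ) : Type := fermionSubalgebra ν

instance fermionSubalgebra_isClosed :
    IsClosed (fermionSubalgebra ν : Set (FermionSpace ν →L[ℂ] FermionSpace ν)) :=
  StarSubalgebra.isClosed_topologicalClosure _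

instance : CompleteSpace (FermionAlgebra ν) :=
  (fermionSubalgebra_isClosed (ν := ν)).completeSpace_coe

/- Instance short-cuts. -/

instance : CStarAlgebra (FermionAlgebra ν) := StarSubalgebra.cstarAlgebra (fermionSubalgebra ν)
instance : Ring (FermionAlgebra ν) := inferInstance
instance : Algebra ℂ (FermionAlgebra ν) := inferInstance
instance : Module ℂ (FermionAlgebra ν) := inferInstance
instance : Module ℝ (FermionAlgebra ν) := inferInstance
instance : AddCommGroup (FermionAlgebra ν) := inferInstance
instance : NormedAddCommGroup (FermionAlgebra ν) := inferInstance
instance : StarRing (FermionAlgebra ν) := inferInstance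
instance : StarModule ℂ (FermionAlgebra ν) := inferInstance
instance : ContinuousStar (FermionAlgebra ν) := inferInstance
instance : IsTopologicalRing (FermionAlgebra ν) := inferInstance
instance : Semiring (FermionAlgebra ν) := inferInstance
instance : NonUnitalNonAssocSemiring (FermionAlgebra ν) := inferInstance
instance : AddCommMonoid (FermionAlgebra ν) := inferInstance
instance : TopologicalSpace (FermionAlgebra ν) := inferInstance
instance : AddZeroClass (FermionAlgebra ν) := inferInstance

/-- The annihilation operator `a_i` as an element of the Fermion algebra; the creation operator is
`star (annihilation i)`. -/
def annihilation (i : Site ν) : FermionAlgebra ν :=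
  ⟨annihilationOp i, StarSubalgebra.le_topologicalClosure _
    (StarAlgebra.subset_adjoin ℂ _ ⟨i, rfl⟩)⟩

/-- The C*-subalgebra `𝓐(I)` generated by `a_i, a_i^*`, `i ∈ I`. -/
def localAlgebra (I : Set (Site ν)) : StarSubalgebra ℂ (FermionAlgebra ν) :=
  (StarAlgebra.adjoin ℂ (annihilation '' I)).topologicalClosure

theorem star_annihilationOp (i : Site ν) : star (annihilationOp i) =
    (1 / 2 : ℂ) • (leftGamma (mode i false) - Complex.I • leftGamma (mode i true)) := by
  simp [annihilationOp, star_leftGamma, sub_eq_add_neg]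

theorem mode_ne {i j : Site ν} (h : i ≠ j) (b c : Bool) : mode i b ≠ mode j c := by
  intro h'
  exact h (congrArg (fun x : Mode ν => ofLex (ofLex x).1) h')

theorem mode_ne' (i : Site ν) : mode i false ≠ mode i true := by
  intro h'
  simpa [mode] using congrArg (fun x => (ofLex x).2) h'

theorem clifford_same {A : Type*} [Ring A] [Algebra ℂ A] {x y : A} (hx : x * x = 1)
    (hy : y * y = 1) (hxy : x * y + y * x = 0) (s t : ℂ) :
    (((1 / 2 : ℂ) • (x + s • y)) * ((1 / 2 : ℂ) • (x + t • y)) +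
      ((1 / 2 : ℂ) • (x + t • y)) * ((1 / 2 : ℂ) • (x + s • y))) =
      ((1 + s * t) / 2) • (1 : A) := by
  have hyx : y * x = - (x * y) := by
    rw [eq_neg_iff_add_eq_zero, add_comm]; exact hxy
  simp only [smul_mul_assoc, mul_smul_comm, add_mul, mul_add, hx, hy, hyx, smul_smul, smul_add]
  module

theorem clifford_diff {A : Type*} [Ring A] [Algebra ℂ A] {x y z w : A} (h1 : x * z + z * x = 0)
    (h2 : x * w + w * x = 0) (h3 : y * z + z * y = 0) (h4 : y * w + w * y = 0) (s t : ℂ) :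
    (((1 / 2 : ℂ) • (x + s • y)) * ((1 / 2 : ℂ) • (z + t • w)) +
      ((1 / 2 : ℂ) • (z + t • w)) * ((1 / 2 : ℂ) • (x + s • y))) = 0 := by
  have e1 : z * x = - (x * z) := by rw [eq_neg_iff_add_eq_zero, add_comm]; exact h1
  have e2 : w * x = - (x * w) := by rw [eq_neg_iff_add_eq_zero, add_comm]; exact h2
  have e3 : z * y = - (y * z) := by rw [eq_neg_iff_add_eq_zero, add_comm]; exact h3
  have e4 : w * y = - (y * w) := by rw [eq_neg_iff_add_eq_zero, add_comm]; exact h4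
  simp only [smul_mul_assoc, mul_smul_comm, add_mul, mul_add, e1, e2, e3, e4, smul_smul, smul_add]
  module

/-- The canonical anticommutation relation `{a_i^*, a_j} = δ_{ij} 1`. -/
theorem car_star (i j : Site ν) :
    star (annihilation i) * annihilation j + annihilation j * star (annihilation i) =
      if i = j then 1 else 0 := by
  apply Subtype.ext
  change star (annihilationOp i) * annihilationOp j + annihilationOp j * star (annihilationOp i) = _
  rw [star_annihilationOp, annihilationOp, sub_eq_add_neg, ← neg_smul]
  split_ifs with h
  · subst h
    rw [clifford_same (leftGamma_mul_self _) (leftGamma_mul_self _)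
      (leftGamma_anticomm (mode_ne' i))]
    simp
  · rw [clifford_diff] <;> first | rfl | exact leftGamma_anticomm (mode_ne h _ _)

/-- The canonical anticommutation relation `{a_i, a_j} = 0`. -/
theorem car (i j : Site ν) :
    annihilation i * annihilation j + annihilation j * annihilation i = 0 := by
  apply Subtype.ext
  change annihilationOp i * annihilationOp j + annihilationOp j * annihilationOp i = 0
  rw [annihilationOp, annihilationOp]
  by_cases h : i = j
  · subst h
    rw [clifford_same (leftGamma_mul_self _) (leftGamma_mul_self _)
      (leftGamma_anticomm (mode_ne' i))]
    simp
  · rw [clifford_diff] <;> exact leftGamma_anticomm (mode_ne h _ _)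

/-- The Fermion algebra is generated by the annihilation and creation operators. -/
theorem localAlgebra_univ : localAlgebra (Set.univ : Set (Site ν)) = ⊤ := by
  rw [eq_top_iff]
  rintro x -
  have hmap : (StarAlgebra.adjoin ℂ (annihilation '' (Set.univ : Set (Site ν)))).map
      (fermionSubalgebra ν).subtype = StarAlgebra.adjoin ℂ (Set.range annihilationOp) := by
    rw [StarAlgHom.map_adjoin, Set.image_univ, ← Set.range_comp]
    rfl
  have hx : (x : FermionSpace ν →L[ℂ] FermionSpace ν) ∈
      closure ((↑) '' (StarAlgebra.adjoin ℂ
        (annihilation '' (Set.univ : Set (Site ν))) : Set (FermionAlgebra ν))) := by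
    have h : (x : FermionSpace ν →L[ℂ] FermionSpace ν) ∈
        (StarAlgebra.adjoin ℂ (Set.range annihilationOp)).topologicalClosure := x.2
    rw [← hmap] at h
    exact h
  change x ∈ closure _
  rw [Topology.IsInducing.subtypeVal.closure_eq_preimage_closure_image]
  exact hx

/-- The Clifford generators `γ_{i,0} = a_i + a_i^*` and `γ_{i,1} = i (a_i^* - a_i)`. -/
def majorana (x : Mode ν) : FermionAlgebra ν :=
  bif (ofLex x).2 then
    Complex.I • (star (annihilation (ofLex (ofLex x).1)) - annihilation (ofLex (ofLex x).1))
  else annihilation (ofLex (ofLex x).1) + star (annihilation (ofLex (ofLex x).1))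

theorem coe_majorana (x : Mode ν) :
    (majorana x : FermionSpace ν →L[ℂ] FermionSpace ν) = leftGamma x := by
  obtain ⟨i, b, rfl⟩ : ∃ i b, x = mode i b := ⟨ofLex (ofLex x).1, (ofLex x).2, rfl⟩
  have h1 : (annihilation i : FermionSpace ν →L[ℂ] FermionSpace ν) = annihilationOp i := rfl
  cases b
  · change (annihilation i : FermionSpace ν →L[ℂ] FermionSpace ν) +
      star (annihilation i : FermionSpace ν →L[ℂ] FermionSpace ν) = _
    rw [h1, star_annihilationOp, annihilationOp]
    module
  · change Complex.I • (star (annihilation i : FermionSpace ν →L[ℂ] FermionSpace ν) -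
      (annihilation i : FermionSpace ν →L[ℂ] FermionSpace ν)) = _
    rw [h1, star_annihilationOp, annihilationOp]
    simp only [smul_sub, smul_add, smul_smul]
    have : Complex.I * (1 / 2 * Complex.I) = - (1 / 2) := by
      linear_combination (1 / 2) * Complex.I_mul_I
    rw [this]
    module

theorem annihilation_eq (i : Site ν) : annihilation i =
    (1 / 2 : ℂ) • (majorana (mode i false) + Complex.I • majorana (mode i true)) := by
  apply Subtype.ext
  change annihilationOp i = (1 / 2 : ℂ) • ((majorana (mode i false) : FermionSpace ν →L[ℂ] _) +
    Complex.I • (majorana (mode i true) : FermionSpace ν →L[ℂ] _))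
  rw [coe_majorana, coe_majorana, annihilationOp]

theorem star_annihilation_eq (i : Site ν) : star (annihilation i) =
    (1 / 2 : ℂ) • (majorana (mode i false) + (-Complex.I) • majorana (mode i true)) := by
  apply Subtype.ext
  change star (annihilationOp i) = (1 / 2 : ℂ) •
    ((majorana (mode i false) : FermionSpace ν →L[ℂ] _) +
    (-Complex.I) • (majorana (mode i true) : FermionSpace ν →L[ℂ] _))
  rw [coe_majorana, coe_majorana, star_annihilationOp, neg_smul, sub_eq_add_neg]

theorem majorana_mem {I : Set (Site ν)} {i : Site ν} (hi : i ∈ I) (b : Bool) :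
    majorana (mode i b) ∈ localAlgebra I := by
  have h : annihilation i ∈ localAlgebra I := StarSubalgebra.le_topologicalClosure _
    (StarAlgebra.subset_adjoin ℂ _ ⟨i, hi, rfl⟩)
  cases b
  · exact add_mem h (star_mem h)
  · exact SMulMemClass.smul_mem _ (sub_mem (star_mem h) h)

theorem localAlgebra_induction {I : Set (Site ν)} {p : FermionAlgebra ν → Prop}
    (hcl : IsClosed {x | p x}) (halg : ∀ c : ℂ, p (algebraMap ℂ _ c))
    (hadd : ∀ x y, p x → p y → p (x + y)) (hmul : ∀ x y, p x → p y → p (x * y))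
    (hgen : ∀ i ∈ I, ∀ b, p (majorana (mode i b))) {x : FermionAlgebra ν}
    (hx : x ∈ localAlgebra I) : p x := by
  have hsmul : ∀ (c : ℂ) y, p y → p (c • y) := fun c y hy => by
    rw [Algebra.smul_def]; exact hmul _ _ (halg c) hy
  have key : ∀ y ∈ StarAlgebra.adjoin ℂ (annihilation '' I), p y := by
    intro y hy
    have hy' : y ∈ Algebra.adjoin ℂ (annihilation '' I ∪ star (annihilation '' I)) := hy
    induction hy' using Algebra.adjoin_induction with
    | mem z hz =>
      rcases hz with ⟨i, hi, rfl⟩ | hz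
      · rw [annihilation_eq]
        exact hsmul _ _ (hadd _ _ (hgen i hi _) (hsmul _ _ (hgen i hi _)))
      · obtain ⟨i, hi, h⟩ := hz
        rw [← star_star z, ← h, star_annihilation_eq]
        exact hsmul _ _ (hadd _ _ (hgen i hi _) (hsmul _ _ (hgen i hi _)))
    | algebraMap c => exact halg c
    | add z w hz hw h1 h2 => exact hadd _ _ (h1 hz) (h2 hw)
    | mul z w hz hw h1 h2 => exact hmul _ _ (h1 hz) (h2 hw)
  exact closure_minimal (s := (StarAlgebra.adjoin ℂ (annihilation '' I) : Set (FermionAlgebra ν)))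
    (fun y hy => key y hy) hcl hx

/-! ### Automorphisms -/

theorem conj_mem (U : FermionSpace ν ≃ₗᵢ[ℂ] FermionSpace ν)
    (h : ∀ i, U.conjStarAlgEquiv (annihilationOp i) ∈ fermionSubalgebra ν)
    (x : FermionAlgebra ν) : U.conjStarAlgEquiv x ∈ fermionSubalgebra ν := by
  have hc : Continuous U.conjStarAlgEquiv := by
    have : (U.conjStarAlgEquiv : (FermionSpace ν →L[ℂ] FermionSpace ν) → _) = fun x =>
      (U : FermionSpace ν →L[ℂ] FermionSpace ν) ∘L x ∘L
        (U.symm : FermionSpace ν →L[ℂ] FermionSpace ν) := by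
      ext1 x; exact U.conjStarAlgEquiv_apply x
    rw [this]
    fun_prop
  have hle : fermionSubalgebra ν ≤
      (fermionSubalgebra ν).comap (U.conjStarAlgEquiv : _ →⋆ₐ[ℂ] _) := by
    refine StarSubalgebra.topologicalClosure_minimal (StarAlgebra.adjoin_le ?_) ?_
    · rintro _ ⟨i, rfl⟩
      exact h i
    · exact fermionSubalgebra_isClosed.preimage hc
  exact hle x.2

/-- The automorphism of the Fermion algebra implemented by a unitary `U`, i.e. `x ↦ U x U^*`. -/
def implemented (U : FermionSpace ν ≃ₗᵢ[ℂ] FermionSpace ν)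
    (h : ∀ i, U.conjStarAlgEquiv (annihilationOp i) ∈ fermionSubalgebra ν)
    (h' : ∀ i, U.symm.conjStarAlgEquiv (annihilationOp i) ∈ fermionSubalgebra ν) :
    FermionAlgebra ν ≃⋆ₐ[ℂ] FermionAlgebra ν :=
  StarAlgEquiv.ofStarAlgHom
    ((U.conjStarAlgEquiv.toStarAlgHom.comp (fermionSubalgebra ν).subtype).codRestrict _
      (conj_mem U h))
    ((U.symm.conjStarAlgEquiv.toStarAlgHom.comp (fermionSubalgebra ν).subtype).codRestrict _
      (conj_mem U.symm h'))
    (by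
      ext x : 1
      apply Subtype.ext
      ext1 f
      change U.symm (U ((x : FermionSpace ν →L[ℂ] FermionSpace ν) (U.symm (U f)))) = _
      simp)
    (by
      ext x : 1
      apply Subtype.ext
      ext1 f
      change U (U.symm ((x : FermionSpace ν →L[ℂ] FermionSpace ν) (U (U.symm f)))) = _
      simp)

/-- The grading unitary `e_S ↦ (-1)^|S| e_S`. -/
def gradingUnitary (ν : ℕ) : FermionSpace ν ≃ₗᵢ[ℂ] FermionSpace ν :=
  signedPerm (Equiv.refl _) Finset.card

/-- Translation of modes, `(i, b) ↦ (i + k, b)`. -/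
def modeShift (k : Site ν) : Equiv.Perm (Mode ν) where
  toFun x := toLex ((ofLex x).1 + toLex k, (ofLex x).2)
  invFun x := toLex ((ofLex x).1 - toLex k, (ofLex x).2)
  left_inv x := by simp
  right_inv x := by simp

/-- The translation unitary `e_S ↦ e_{S + k}`. -/
def shiftUnitary (k : Site ν) : FermionSpace ν ≃ₗᵢ[ℂ] FermionSpace ν :=
  signedPerm (modeShift k).finsetCongr 0

theorem conj_grading_leftGamma (x : Mode ν) :
    (gradingUnitary ν).conjStarAlgEquiv (leftGamma x) = - leftGamma x := by
  have hU : ∀ S, gradingUnitary ν (ket S) = (-1 : ℂ) ^ S.card • ket S := fun S =>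
    signedPerm_ket _ _ _
  have hs : ∀ S, (gradingUnitary ν).symm (ket S) = (-1 : ℂ) ^ S.card • ket S := fun S => by
    rw [LinearIsometryEquiv.symm_apply_eq, map_smul, hU, smul_smul, ← pow_add]
    simp
  refine ext_ket fun S => ?_
  have h := sign_filter_symmDiff (fun _ : Mode ν => True) S x
  simp only [Finset.filter_true, if_true] at h
  rw [LinearIsometryEquiv.conjStarAlgEquiv_apply_apply, hs, map_smul, leftGamma_ket, map_smul,
    map_smul, hU, neg_apply, leftGamma_ket, h, smul_smul, smul_smul, ← neg_smul]
  congr 1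
  have h1 : (-1 : ℂ) ^ S.card * (-1 : ℂ) ^ S.card = 1 := by
    rw [← pow_add]; simp
  linear_combination -((-1 : ℂ) ^ (Finset.filter (· < x) S).card) * h1

theorem modeShift_lt (k : Site ν) (x y : Mode ν) : modeShift k x < modeShift k y ↔ x < y := by
  rw [Prod.Lex.lt_iff, Prod.Lex.lt_iff]
  simp [modeShift]

theorem conj_shift_leftGamma (k : Site ν) (x : Mode ν) :
    (shiftUnitary k).conjStarAlgEquiv (leftGamma x) = leftGamma (modeShift k x) := by
  have hU : ∀ S, shiftUnitary k (ket S) = ket (S.map (modeShift k).toEmbedding) := fun S => by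
    rw [shiftUnitary, signedPerm_ket]; simp
  refine ext_ket fun T => ?_
  obtain ⟨S, rfl⟩ : ∃ S : Finset (Mode ν), T = S.map (modeShift k).toEmbedding :=
    ⟨(modeShift k).finsetCongr.symm T, ((modeShift k).finsetCongr.apply_symm_apply T).symm⟩
  have hs : (shiftUnitary k).symm (ket (S.map (modeShift k).toEmbedding)) = ket S := by
    rw [LinearIsometryEquiv.symm_apply_eq, hU]
  rw [LinearIsometryEquiv.conjStarAlgEquiv_apply_apply, hs, leftGamma_ket, map_smul, hU,
    leftGamma_ket]
  congr 2
  · rw [Finset.filter_map, Finset.card_map]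
    simp [modeShift_lt]
  · ext z
    obtain ⟨w, rfl⟩ := (modeShift k).surjective z
    simp [Finset.mem_symmDiff]

theorem modeShift_mode (k i : Site ν) (b : Bool) :
    modeShift k (mode i b) = mode (i + k) b := rfl

theorem conj_grading_annihilationOp (i : Site ν) :
    (gradingUnitary ν).conjStarAlgEquiv (annihilationOp i) = - annihilationOp i := by
  rw [annihilationOp, map_smul, map_add, map_smul, conj_grading_leftGamma, conj_grading_leftGamma]
  module

theorem conj_shift_annihilationOp (k i : Site ν) :
    (shiftUnitary k).conjStarAlgEquiv (annihilationOp i) = annihilationOp (i + k) := by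
  rw [annihilationOp, map_smul, map_add, map_smul, conj_shift_leftGamma, conj_shift_leftGamma]
  rfl

theorem annihilationOp_mem (i : Site ν) : annihilationOp i ∈ fermionSubalgebra ν :=
  (annihilation i).2

/-- The automorphism `Θ` with `Θ(a_i) = -a_i` for all `i`. -/
def theta (ν : ℕ) : FermionAlgebra ν ≃⋆ₐ[ℂ] FermionAlgebra ν :=
  implemented (gradingUnitary ν)
    (fun i => by rw [conj_grading_annihilationOp]; exact neg_mem (annihilationOp_mem i))
    (fun i => by
      rw [← LinearIsometryEquiv.symm_conjStarAlgEquiv, ← neg_neg (annihilationOp i),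
        ← conj_grading_annihilationOp, map_neg, StarAlgEquiv.symm_apply_apply]
      exact neg_mem (annihilationOp_mem i))

/-- The lattice translation automorphism `τ_k`, with `τ_k(a_i) = a_{i+k}`. -/
def shift (k : Site ν) : FermionAlgebra ν ≃⋆ₐ[ℂ] FermionAlgebra ν :=
  implemented (shiftUnitary k)
    (fun i => by rw [conj_shift_annihilationOp]; exact annihilationOp_mem _)
    (fun i => by
      rw [← LinearIsometryEquiv.symm_conjStarAlgEquiv, ← sub_add_cancel i k,
        ← conj_shift_annihilationOp, StarAlgEquiv.symm_apply_apply]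
      exact annihilationOp_mem _)

theorem theta_annihilation (i : Site ν) : theta ν (annihilation i) = - annihilation i :=
  Subtype.ext (conj_grading_annihilationOp i)

theorem shift_annihilation (k i : Site ν) : shift k (annihilation i) = annihilation (i + k) :=
  Subtype.ext (conj_shift_annihilationOp k i)

/-! ### Tracial state and conditional expectations -/

theorem star_rightGamma {X : Type*} [LinearOrder X] (x : X) :
    star (rightGamma x) = rightGamma x := by
  have h0 : rightGamma x * rightGamma x = 1 := by
    refine ext_ket fun S => ?_
    rw [mul_apply_eq_comp, rightGamma_ket, map_smul, rightGamma_ket,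
      sign_filter_symmDiff, smul_smul, symmDiff_symmDiff_cancel_right]
    simp [← pow_add]
  have h1 : star (rightGamma x) * rightGamma x = 1 := by
    rw [rightGamma, ContinuousLinearMap.star_eq_adjoint]
    erw [LinearIsometryEquiv.adjoint_eq_symm]
    ext1 f
    exact LinearIsometryEquiv.symm_apply_apply _ f
  calc star (rightGamma x) = star (rightGamma x) * (rightGamma x * rightGamma x) := by
        rw [h0, mul_one]
    _ = rightGamma x := by rw [← mul_assoc, h1, one_mul]

theorem coe_mul_rightGamma (a : FermionAlgebra ν) (y : Mode ν) :
    (a : FermionSpace ν →L[ℂ] FermionSpace ν) * rightGamma y = rightGamma y * a := by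
  have ha : a ∈ localAlgebra (Set.univ : Set (Site ν)) := by simp [localAlgebra_univ]
  refine localAlgebra_induction (p := fun a : FermionAlgebra ν =>
    (a : FermionSpace ν →L[ℂ] FermionSpace ν) * rightGamma y = rightGamma y * a)
    ?_ ?_ ?_ ?_ ?_ ha
  · exact isClosed_eq (by fun_prop) (by fun_prop)
  · intro c
    exact Algebra.commutes c (rightGamma y)
  · intro x z hx hz
    simp only [AddMemClass.coe_add, add_mul, mul_add, hx, hz]
  · intro x z hx hz
    simp only [MulMemClass.coe_mul]
    rw [mul_assoc, hz, ← mul_assoc, hx, mul_assoc]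
  · intro i _ b
    rw [coe_majorana]
    exact leftGamma_rightGamma_comm _ _

/-- The vacuum vector is separating for the Fermion algebra. -/
theorem ext_vacuum {a b : FermionAlgebra ν}
    (h : (a : FermionSpace ν →L[ℂ] FermionSpace ν) (vacuum ν) =
      (b : FermionSpace ν →L[ℂ] FermionSpace ν) (vacuum ν)) : a = b := by
  apply Subtype.ext
  refine ext_ket fun S => ?_
  obtain ⟨R, hR, hS⟩ := rightGamma_cyclic S
  have hcomm : ∀ c : FermionAlgebra ν,
      (c : FermionSpace ν →L[ℂ] FermionSpace ν) * R = R * c := by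
    intro c
    clear hS
    induction hR using Submonoid.closure_induction with
    | mem z hz => obtain ⟨y, rfl⟩ := hz; exact coe_mul_rightGamma c y
    | one => rw [mul_one, one_mul]
    | mul z w _ _ h1 h2 => rw [← mul_assoc, h1, mul_assoc, h2, mul_assoc]
  rw [← hS, ← mul_apply_eq_comp, ← mul_apply_eq_comp, hcomm, hcomm, mul_apply_eq_comp,
    mul_apply_eq_comp, h]

/-- The tracial state `τ` of the Fermion algebra. -/
def tau (ν : ℕ) : FermionAlgebra ν →ₗ[ℂ] ℂ where
  toFun a := ⟪vacuum ν, (a : FermionSpace ν →L[ℂ] FermionSpace ν) (vacuum ν)⟫_ℂ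
  map_add' _ _ := inner_add_right _ _ _
  map_smul' _ _ := inner_smul_right _ _ _

theorem tau_apply (a : FermionAlgebra ν) : tau ν a =
    ⟪vacuum ν, (a : FermionSpace ν →L[ℂ] FermionSpace ν) (vacuum ν)⟫_ℂ := rfl

theorem tau_one : tau ν 1 = 1 := by
  classical
  rw [tau_apply, inner_ket_left]
  change (ket ∅ : FermionSpace ν) ∅ = 1
  rw [ket_apply, if_pos rfl]

theorem tau_star_mul (a b : FermionAlgebra ν) : tau ν (star a * b) =
    ⟪(a : FermionSpace ν →L[ℂ] FermionSpace ν) (vacuum ν),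
      (b : FermionSpace ν →L[ℂ] FermionSpace ν) (vacuum ν)⟫_ℂ := by
  rw [← ContinuousLinearMap.adjoint_inner_right]
  rfl

theorem star_majorana (x : Mode ν) : star (majorana x) = majorana x := by
  apply Subtype.ext
  change star (majorana x : FermionSpace ν →L[ℂ] FermionSpace ν) = _
  rw [coe_majorana, star_leftGamma]

theorem continuous_tau : Continuous (tau ν) := by
  change Continuous fun a : FermionAlgebra ν =>
    ⟪vacuum ν, (a : FermionSpace ν →L[ℂ] FermionSpace ν) (vacuum ν)⟫_ℂ
  fun_prop

/-- `τ` is a trace. -/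
theorem tau_mul_comm (a b : FermionAlgebra ν) : tau ν (a * b) = tau ν (b * a) := by
  have ha : a ∈ localAlgebra (Set.univ : Set (Site ν)) := by simp [localAlgebra_univ]
  refine localAlgebra_induction (p := fun a : FermionAlgebra ν =>
    ∀ b, tau ν (a * b) = tau ν (b * a)) ?_ ?_ ?_ ?_ ?_ ha b
  · simp only [Set.ofPred_forall]
    exact isClosed_iInter fun b => isClosed_eq (continuous_tau.comp (by fun_prop))
      (continuous_tau.comp (by fun_prop))
  · intro c b
    rw [Algebra.commutes]
  · intro x z hx hz b
    rw [add_mul, mul_add, map_add, map_add, hx, hz]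
  · intro x z hx hz b
    rw [mul_assoc, hx, mul_assoc, hz, mul_assoc]
  · intro i _ s b
    set x := mode i s
    have h1 : leftGamma x (vacuum ν) = rightGamma x (vacuum ν) := by
      rw [leftGamma_ket, rightGamma_ket]; simp
    have h2 : ⟪vacuum ν, (rightGamma x)
        ((b : FermionSpace ν →L[ℂ] FermionSpace ν) (vacuum ν))⟫_ℂ =
        ⟪rightGamma x (vacuum ν), (b : FermionSpace ν →L[ℂ] FermionSpace ν) (vacuum ν)⟫_ℂ := by
      rw [← ContinuousLinearMap.adjoint_inner_right, ← ContinuousLinearMap.star_eq_adjoint,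
        star_rightGamma]
    have h3 : (b : FermionSpace ν →L[ℂ] FermionSpace ν) (rightGamma x (vacuum ν)) =
        rightGamma x ((b : FermionSpace ν →L[ℂ] FermionSpace ν) (vacuum ν)) :=
      congrArg (fun A => A (vacuum ν)) (coe_mul_rightGamma b x)
    rw [← star_majorana x, tau_star_mul, star_majorana, coe_majorana, tau_apply]
    change _ = ⟪vacuum ν, (b : FermionSpace ν →L[ℂ] FermionSpace ν)
      ((majorana x : FermionSpace ν →L[ℂ] FermionSpace ν) (vacuum ν))⟫_ℂ
    rw [coe_majorana, h1, h3, h2]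

/-- The monomial `γ_S` in the Fermion algebra. The `γ_S` are orthonormal for `⟨a, b⟩ = τ(a^* b)`. -/
def monomial (S : Finset (Mode ν)) : FermionAlgebra ν := orderedProd majorana S

theorem monomial_vacuum (S : Finset (Mode ν)) :
    (monomial S : FermionSpace ν →L[ℂ] FermionSpace ν) (vacuum ν) = ket S := by
  rw [← leftGamma_prod_vacuum S]
  congr 1
  change (fermionSubalgebra ν).subtype (orderedProd majorana S) = _
  rw [orderedProd, map_list_prod, List.map_map, orderedProd]
  congr 2
  funext x
  exact coe_majorana x

theorem tau_star_monomial_mul (S T : Finset (Mode ν)) :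
    tau ν (star (monomial S) * monomial T) = if S = T then 1 else 0 := by
  classical
  rw [tau_star_mul, monomial_vacuum, monomial_vacuum, inner_ket_left, ket_apply]
  congr

theorem majorana_mul_monomial (x : Mode ν) (S : Finset (Mode ν)) :
    majorana x * monomial S = (-1 : ℂ) ^ (S.filter (· < x)).card • monomial (S ∆ {x}) := by
  apply ext_vacuum
  change (majorana x : FermionSpace ν →L[ℂ] FermionSpace ν)
    ((monomial S : FermionSpace ν →L[ℂ] FermionSpace ν) (vacuum ν)) =
    (-1 : ℂ) ^ (S.filter (· < x)).card •
      ((monomial (S ∆ {x}) : FermionSpace ν →L[ℂ] FermionSpace ν) (vacuum ν))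
  rw [monomial_vacuum, monomial_vacuum, coe_majorana, leftGamma_ket]
  congr!

/-- The modes of the sites in `J`. -/
def modes (J : Finset (Site ν)) : Finset (Mode ν) :=
  (J ×ˢ Finset.univ).image fun p => mode p.1 p.2

theorem monomial_mem {J : Finset (Site ν)} {S : Finset (Mode ν)} (hS : S ⊆ modes J) :
    monomial S ∈ localAlgebra (J : Set (Site ν)) := by
  refine list_prod_mem fun y hy => ?_
  obtain ⟨x, hx, rfl⟩ := List.mem_map.mp hy
  obtain ⟨⟨i, b⟩, hp, rfl⟩ := Finset.mem_image.mp (hS ((Finset.mem_sort _).mp hx))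
  exact majorana_mem (by simpa using hp) b

/-- For finite `J`, the conditional expectation `E_J : 𝓐 → 𝓐(J)` with respect to the tracial state
`τ`, i.e. the orthogonal projection onto `𝓐(J)` for `⟨a, b⟩ = τ(a^* b)`. -/
def condExp (J : Finset (Site ν)) : FermionAlgebra ν →ₗ[ℂ] FermionAlgebra ν where
  toFun a := ∑ S ∈ (modes J).powerset, tau ν (star (monomial S) * a) • monomial S
  map_add' a b := by simp [mul_add, add_smul, Finset.sum_add_distrib]
  map_smul' c a := by simp [mul_smul, Finset.smul_sum]

theorem condExp_apply (J : Finset (Site ν)) (a : FermionAlgebra ν) : condExp J a =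
    ∑ S ∈ (modes J).powerset, tau ν (star (monomial S) * a) • monomial S := rfl

theorem condExp_mem (J : Finset (Site ν)) (a : FermionAlgebra ν) :
    condExp J a ∈ localAlgebra (J : Set (Site ν)) :=
  sum_mem fun _ hS => SMulMemClass.smul_mem _ (monomial_mem (Finset.mem_powerset.mp hS))

theorem mem_span_monomial {J : Finset (Site ν)} {a : FermionAlgebra ν}
    (ha : a ∈ localAlgebra (J : Set (Site ν))) :
    a ∈ Submodule.span ℂ (monomial '' ((modes J).powerset : Set (Finset (Mode ν)))) := by
  set T := Submodule.span ℂ (monomial '' ((modes J).powerset : Set (Finset (Mode ν)))) with hT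
  have hfin : FiniteDimensional ℂ T :=
    FiniteDimensional.span_of_finite ℂ (Set.Finite.image _ (Finset.finite_toSet _))
  have hcl : IsClosed (T : Set (FermionAlgebra ν)) := T.closed_of_finiteDimensional
  have h1 : (1 : FermionAlgebra ν) ∈ T :=
    Submodule.subset_span ⟨∅, by simp, by simp [monomial, orderedProd]⟩
  suffices h : ∀ t ∈ T, a * t ∈ T by simpa using h 1 h1
  refine localAlgebra_induction (p := fun a : FermionAlgebra ν => ∀ t ∈ T, a * t ∈ T)
    ?_ ?_ ?_ ?_ ?_ ha
  · simp only [Set.ofPred_forall]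
    exact isClosed_iInter fun t => isClosed_iInter fun _ => hcl.preimage (by fun_prop)
  · intro c t ht
    rw [← Algebra.smul_def]
    exact T.smul_mem c ht
  · intro x y hx hy t ht
    rw [add_mul]
    exact T.add_mem (hx t ht) (hy t ht)
  · intro x y hx hy t ht
    rw [mul_assoc]
    exact hx _ (hy t ht)
  · intro i hi b t ht
    induction ht using Submodule.span_induction with
    | mem z hz =>
      obtain ⟨S, hS, rfl⟩ := hz
      rw [majorana_mul_monomial]
      refine T.smul_mem _ (Submodule.subset_span ⟨_, ?_, rfl⟩)
      have hi' : mode i b ∈ modes J :=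
        Finset.mem_image.mpr ⟨(i, b), by simpa using hi, rfl⟩
      rw [Finset.mem_coe, Finset.mem_powerset] at hS ⊢
      intro z hz
      rcases Finset.mem_symmDiff.mp hz with h | h
      · exact hS h.1
      · rw [Finset.mem_singleton.mp h.1]; exact hi'
    | zero => simp
    | add y z _ _ hy hz => rw [mul_add]; exact T.add_mem hy hz
    | smul c y _ hy => rw [mul_smul_comm]; exact T.smul_mem c hy

/-- The defining property of the conditional expectation. -/
theorem tau_condExp_mul (J : Finset (Site ν)) (a : FermionAlgebra ν) {b : FermionAlgebra ν}
    (hb : b ∈ localAlgebra (J : Set (Site ν))) : tau ν (condExp J a * b) = tau ν (a * b) := by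
  suffices h : ∀ c ∈ Submodule.span ℂ (monomial '' ((modes J).powerset : Set (Finset (Mode ν)))),
      tau ν (star c * condExp J a) = tau ν (star c * a) by
    rw [tau_mul_comm, tau_mul_comm a b]
    simpa using h (star b) (mem_span_monomial (star_mem hb))
  intro c hc
  induction hc using Submodule.span_induction with
  | mem z hz =>
    obtain ⟨S, hS, rfl⟩ := hz
    rw [condExp_apply, Finset.mul_sum, map_sum, Finset.sum_eq_single_of_mem S hS]
    · rw [mul_smul_comm, map_smul, tau_star_monomial_mul]; simp
    · intro T _ hT
      rw [mul_smul_comm, map_smul, tau_star_monomial_mul, if_neg hT.symm]; simp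
  | zero => simp
  | add y z _ _ hy hz => simp [add_mul, hy, hz]
  | smul c y _ hy => simp [hy]

/-- The conditional expectation is uniquely determined by its defining property. -/
theorem eq_condExp (J : Finset (Site ν)) {a e : FermionAlgebra ν}
    (he : e ∈ localAlgebra (J : Set (Site ν)))
    (h : ∀ b ∈ localAlgebra (J : Set (Site ν)), tau ν (e * b) = tau ν (a * b)) :
    e = condExp J a := by
  have hmem : e - condExp J a ∈ localAlgebra (J : Set (Site ν)) := sub_mem he (condExp_mem J a)
  have h0 : tau ν (star (e - condExp J a) * (e - condExp J a)) = 0 := by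
    rw [tau_mul_comm, sub_mul, map_sub, h _ (star_mem hmem),
      tau_condExp_mul J a (star_mem hmem), sub_self]
  rw [tau_star_mul, inner_self_eq_zero] at h0
  rw [← sub_eq_zero]
  exact ext_vacuum h0

end FermionAlgebra

section Potential

variable {ν : ℕ}

/-- The sum of all `Φ(K)` with `K ∩ I ≠ ∅` and `K ⊆ J`. -/
def partialHamiltonian (Φ : Finset (Site ν) → FermionAlgebra ν) (I J : Finset (Site ν)) :
    FermionAlgebra ν :=
  ∑ K ∈ J.powerset with (K ∩ I).Nonempty, Φ K

/-- The local Hamiltonian `H(I)`: the limit of `partialHamiltonian Φ I J` along the net of all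
finite subsets `J` of the lattice. -/
def localHamiltonian (Φ : Finset (Site ν) → FermionAlgebra ν) (I : Finset (Site ν)) :
    FermionAlgebra ν :=
  limUnder atTop (partialHamiltonian Φ I)

/-- Standard potentials: `Φ(I) ∈ 𝓐(I)` is self-adjoint and `Θ`-even, `Φ(∅) = 0`,
`E_J(Φ(I)) = 0` for every proper subset `J` of `I`, and the sums defining `H(I)` form a Cauchy net
in norm, indexed by the finite subsets `J` of the lattice. -/
structure IsStandardPotential (Φ : Finset (Site ν) → FermionAlgebra ν) : Prop where
  mem_localAlgebra : ∀ I : Finset (Site ν), Φ I ∈ localAlgebra (I : Set (Site ν))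
  map_empty : Φ ∅ = 0
  star_eq : ∀ I, star (Φ I) = Φ I
  theta_eq : ∀ I, theta ν (Φ I) = Φ I
  condExp_eq_zero : ∀ I J, J ⊂ I → condExp J (Φ I) = 0
  cauchy : ∀ I, CauchySeq (partialHamiltonian Φ I)

/-- The translate `I + k`. -/
def translate (I : Finset (Site ν)) (k : Site ν) : Finset (Site ν) :=
  I.map (Equiv.addRight k).toEmbedding

/-- Translation covariance `τ_k(Φ(I)) = Φ(I + k)`. -/
def IsTranslationCovariant (Φ : Finset (Site ν) → FermionAlgebra ν) : Prop :=
  ∀ I k, shift k (Φ I) = Φ (translate I k)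

theorem IsStandardPotential.tendsto {Φ : Finset (Site ν) → FermionAlgebra ν}
    (h : IsStandardPotential Φ) (I : Finset (Site ν)) :
    Tendsto (partialHamiltonian Φ I) atTop (𝓝 (localHamiltonian Φ I)) :=
  (h.cauchy I).tendsto_limUnder

theorem partialHamiltonian_add (Φ Ψ : Finset (Site ν) → FermionAlgebra ν)
    (I : Finset (Site ν)) :
    partialHamiltonian (Φ + Ψ) I = partialHamiltonian Φ I + partialHamiltonian Ψ I := by
  funext J; simp [partialHamiltonian, Finset.sum_add_distrib]

theorem partialHamiltonian_smul (c : ℝ) (Φ : Finset (Site ν) → FermionAlgebra ν)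
    (I : Finset (Site ν)) :
    partialHamiltonian (c • Φ) I = c • partialHamiltonian Φ I := by
  funext J; simp [partialHamiltonian, Finset.smul_sum]

/-- The real vector space of all translation covariant standard potentials, with pointwise linear
operations. -/
def potentialSubmodule (ν : ℕ) : Submodule ℝ (Finset (Site ν) → FermionAlgebra ν) where
  carrier := {Φ | IsStandardPotential Φ ∧ IsTranslationCovariant Φ}
  zero_mem' := by
    refine ⟨⟨fun I => zero_mem _, rfl, fun I => star_zero _, fun I => map_zero _,
      fun I J _ => map_zero _, fun I => ?_⟩, fun I k => map_zero _⟩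
    have : partialHamiltonian (0 : Finset (Site ν) → FermionAlgebra ν) I = fun _ => 0 := by
      funext J; simp [partialHamiltonian]
    rw [this]
    exact cauchySeq_const 0
  add_mem' := by
    rintro Φ Ψ ⟨h, h'⟩ ⟨g, g'⟩
    refine ⟨⟨fun I => add_mem (h.1 I) (g.1 I), ?_, fun I => ?_, fun I => ?_, fun I J hJ => ?_,
      fun I => ?_⟩, fun I k => ?_⟩
    · simp [h.map_empty, g.map_empty]
    · simp [h.star_eq, g.star_eq]
    · simp [h.theta_eq, g.theta_eq]
    · simp [h.condExp_eq_zero I J hJ, g.condExp_eq_zero I J hJ]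
    · rw [partialHamiltonian_add]
      exact (h.cauchy I).add (g.cauchy I)
    · simp [h' I k, g' I k]
  smul_mem' := by
    rintro c Φ ⟨h, h'⟩
    have hc : ∀ x : FermionAlgebra ν, c • x = (c : ℂ) • x := fun x => rfl
    refine ⟨⟨fun I => ?_, ?_, fun I => ?_, fun I => ?_, fun I J hJ => ?_,
      fun I => ?_⟩, fun I k => ?_⟩
    · exact SMulMemClass.smul_mem (c : ℂ) (h.1 I)
    · simp [h.map_empty]
    · rw [Pi.smul_apply, hc, star_smul, h.star_eq]; simp
    · rw [Pi.smul_apply, hc, map_smul, h.theta_eq]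
    · rw [Pi.smul_apply, hc, map_smul, h.condExp_eq_zero I J hJ, smul_zero]
    · rw [partialHamiltonian_smul]
      exact (uniformContinuous_const_smul c).comp_cauchySeq (h.cauchy I)
    · rw [Pi.smul_apply, hc, map_smul, h' I k]; rfl

/-- The space `P_τ` of translation covariant standard potentials, as a type of its own: it carries
the linear structure of `potentialSubmodule ν`, but not its topology of pointwise convergence. -/
def PotentialSpace (ν : ℕ) : Type := potentialSubmodule ν

instance : AddCommGroup (PotentialSpace ν) := inferInstanceAs (AddCommGroup (potentialSubmodule ν))

instance : Module ℝ (PotentialSpace ν) := inferInstanceAs (Module ℝ (potentialSubmodule ν))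

instance : CoeFun (PotentialSpace ν) fun _ => Finset (Site ν) → FermionAlgebra ν :=
  ⟨fun Φ => Φ.1⟩

/-- `‖Φ‖ = ‖H({0})‖` (by translation covariance, the origin may be replaced by any site). -/
instance : Norm (PotentialSpace ν) := ⟨fun Φ => ‖localHamiltonian Φ {0}‖⟩

/-- The Euclidean diameter `max {|i - j| ; i, j ∈ I}` (which is `0` if `I = ∅`). -/
def siteDiam (I : Finset (Site ν)) : ℝ :=
  Metric.diam ((fun i : Site ν => (WithLp.toLp 2 fun t => (i t : ℝ) : EuclideanSpace ℝ (Fin ν))) ''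
    (I : Set (Site ν)))

/-- `Φ` has finite range: for some `r ≥ 0`, `Φ(I) = 0` whenever `diam(I) > r`. -/
def IsFiniteRange (Φ : Finset (Site ν) → FermionAlgebra ν) : Prop :=
  ∃ r : ℝ, 0 ≤ r ∧ ∀ I, r < siteDiam I → Φ I = 0

/-- The subspace of finite range potentials in `P_τ`. -/
def finiteRangeSubmodule (ν : ℕ) : Submodule ℝ (PotentialSpace ν) where
  carrier := {Φ | IsFiniteRange Φ}
  zero_mem' := ⟨0, le_rfl, fun _ _ => rfl⟩
  add_mem' := by
    rintro Φ Ψ ⟨r, hr, h⟩ ⟨s, hs, g⟩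
    refine ⟨max r s, le_max_of_le_left hr, fun I hI => ?_⟩
    change Φ.1 I + Ψ.1 I = 0
    rw [h I ((le_max_left _ _).trans_lt hI), g I ((le_max_right _ _).trans_lt hI), add_zero]
  smul_mem' := by
    rintro c Φ ⟨r, hr, h⟩
    refine ⟨r, hr, fun I hI => ?_⟩
    change c • Φ.1 I = 0
    rw [h I hI, smul_zero]

end Potential

end

end FermionLattice

/-! Everything rests on two facts about the conditional expectations $E_J$. They are norm
contractions (`norm_condExp_le`): $\mathcal A(J)$ acts faithfully on $\mathcal A(J)\Omega$ because
the vacuum $\Omega$ is separating, so its C*-norm can be computed there, and on that space $E_J(a)$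
is the compression of $a$. Moreover standardness gives $E_J(H_\Phi(I))=$ the partial sum over
$K\subset J$ (`IsStandardPotential.condExp_localHamiltonian`), so every partial sum is bounded by
$\|H_\Phi(I)\|$.

Norm: translations act by isometric automorphisms, so the site is irrelevant. Induction on $K$
recovers $\Phi(K)$ from partial sums at one site, with a bound $\|\Phi(K)\|\le C_K\|\Phi\|$
(`exists_norm_apply_le`); this gives definiteness.

Completeness: a Cauchy sequence converges pointwise by that bound. The single-site partial sums
converge uniformly in site and region, those for general $I$ are controlled by $|I|$ single-site
ones, and so the Cauchy condition passes to the limit.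

Separability: $\Phi\mapsto H_\Phi(\{0\})$ is an isometry into the closed span of the countably many
monomials.

Density: multiply $\Phi(K)$ by $\#\{k : K\subset J+k\}/|J|$. The result has finite range, since $K$
must fit into a translate of $J$, and its Hamiltonian at the origin is the average of
$E_{J+k}(H_\Phi(\{0\}))$ over the translates containing $0$. For a large cube $J$ nearly all of
these contain a prescribed region, where $E_{J+k}(H_\Phi(\{0\}))$ is close to $H_\Phi(\{0\})$; the
rest have vanishing proportion and bounded error. -/

namespace FermionLattice

open Filter Topology
open scoped lp ENNReal symmDiff InnerProductSpace

noncomputable section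

/-! ### Computing a C*-norm on an invariant subspace -/

section InvariantSubspace

variable {H A : Type*} [NormedAddCommGroup H] [InnerProductSpace ℂ H] {V : Submodule ℂ H}

/-- The restriction of an operator to an invariant subspace. -/
def restrictOp (T : H →L[ℂ] H) (h : ∀ f ∈ V, T f ∈ V) : V →L[ℂ] V :=
  (T ∘L V.subtypeL).codRestrict _ fun f => h f f.2

theorem coe_restrictOp (T : H →L[ℂ] H) (h : ∀ f ∈ V, T f ∈ V) (f : V) :
    (restrictOp T h f : H) = T f := rfl

variable [CompleteSpace H] [CStarAlgebra A] {ρ : A →⋆ₐ[ℂ] (H →L[ℂ] H)}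

/-- The restriction of a representation to an invariant subspace. -/
def subrepresentation [CompleteSpace V] (hV : ∀ a, ∀ f ∈ V, ρ a f ∈ V) :
    A →⋆ₐ[ℂ] (V →L[ℂ] V) where
  toFun a := restrictOp (ρ a) (hV a)
  map_one' := by ext f; simp [coe_restrictOp]
  map_mul' a b := by ext f; simp [coe_restrictOp]
  map_zero' := by ext f; simp [coe_restrictOp]
  map_add' a b := by ext f; simp [coe_restrictOp]
  commutes' c := by
    ext f
    rw [coe_restrictOp, AlgHomClass.commutes]
    rfl
  map_star' a := by
    rw [ContinuousLinearMap.star_eq_adjoint]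
    refine (ContinuousLinearMap.eq_adjoint_iff _ _).mpr fun f g => ?_
    rw [Submodule.coe_inner, Submodule.coe_inner, coe_restrictOp, coe_restrictOp, map_star,
      ContinuousLinearMap.star_eq_adjoint, ContinuousLinearMap.adjoint_inner_left]

/-- If a representation is faithful on an invariant subspace, the norm can be computed there. -/
theorem norm_le_of_subrepresentation [CompleteSpace V] (hV : ∀ a, ∀ f ∈ V, ρ a f ∈ V)
    (hinj : ∀ a, (∀ f ∈ V, ρ a f = 0) → a = 0) {a : A} {C : ℝ} (hC : 0 ≤ C)
    (h : ∀ f ∈ V, ‖ρ a f‖ ≤ C * ‖f‖) : ‖a‖ ≤ C := by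
  have hi : Function.Injective (subrepresentation hV) := by
    refine (injective_iff_map_eq_zero _).mpr fun b hb => hinj b fun f hf => ?_
    exact congrArg Subtype.val (congrArg (fun T : V →L[ℂ] V => T ⟨f, hf⟩) hb)
  -- An injective *-homomorphism of C*-algebras is isometric.
  rw [← NonUnitalStarAlgHom.norm_map _ hi]
  exact ContinuousLinearMap.opNorm_le_bound _ hC fun f => h f f.2

end InvariantSubspace

/-! ### Conditional expectations are contractions -/

section LocalContraction

variable {ν : ℕ}

instance localAlgebra_isClosed (I : Set (Site ν)) :
    IsClosed (localAlgebra I : Set (FermionAlgebra ν)) :=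
  StarSubalgebra.isClosed_topologicalClosure _

instance (I : Set (Site ν)) : CStarAlgebra (localAlgebra I) :=
  StarSubalgebra.cstarAlgebra (localAlgebra I)

/-- Evaluation of an element of the Fermion algebra at the vacuum vector. -/
def evalVacuum (ν : ℕ) : FermionAlgebra ν →ₗ[ℂ] FermionSpace ν where
  toFun a := (a : FermionSpace ν →L[ℂ] FermionSpace ν) (vacuum ν)
  map_add' _ _ := rfl
  map_smul' _ _ := rfl

theorem evalVacuum_apply (a : FermionAlgebra ν) :
    evalVacuum ν a = (a : FermionSpace ν →L[ℂ] FermionSpace ν) (vacuum ν) := rfl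

/-- The subspace `𝓐(J) Ω` of the Hilbert space. -/
def localSpace (J : Set (Site ν)) : Submodule ℂ (FermionSpace ν) :=
  (Subalgebra.toSubmodule (localAlgebra J).toSubalgebra).map (evalVacuum ν)

theorem mem_localSpace {J : Set (Site ν)} {f : FermionSpace ν} :
    f ∈ localSpace J ↔ ∃ c ∈ localAlgebra J, evalVacuum ν c = f := Iff.rfl

/-- Finitely many monomials span $\mathcal A(J)$. This makes $\mathcal A(J)\Omega$ complete, as
`norm_le_of_subrepresentation` requires. -/
instance (J : Finset (Site ν)) : FiniteDimensional ℂ (localSpace (J : Set (Site ν))) := by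
  have hfin : FiniteDimensional ℂ (Submodule.span ℂ
      (monomial '' ((modes J).powerset : Set (Finset (Mode ν))))) :=
    FiniteDimensional.span_of_finite ℂ (Set.Finite.image _ (Finset.finite_toSet _))
  have h : FiniteDimensional ℂ
      (Subalgebra.toSubmodule (localAlgebra (J : Set (Site ν))).toSubalgebra) :=
    Submodule.finiteDimensional_of_le (fun a ha => mem_span_monomial ha)
  unfold localSpace
  infer_instance

theorem apply_mem_localSpace {J : Set (Site ν)} {b : FermionAlgebra ν} (hb : b ∈ localAlgebra J)
    {f : FermionSpace ν} (hf : f ∈ localSpace J) :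
    (b : FermionSpace ν →L[ℂ] FermionSpace ν) f ∈ localSpace J := by
  obtain ⟨c, hc, rfl⟩ := mem_localSpace.mp hf
  exact mem_localSpace.mpr ⟨b * c, mul_mem hb hc, rfl⟩

/-- The conditional expectation is a contraction. -/
theorem norm_condExp_le (J : Finset (Site ν)) (a : FermionAlgebra ν) : ‖condExp J a‖ ≤ ‖a‖ := by
  have hΩ : vacuum ν ∈ localSpace (J : Set (Site ν)) := mem_localSpace.mpr ⟨1, one_mem _, rfl⟩
  -- The action on $\mathcal A(J)\Omega$ is faithful: an element vanishing there kills $\Omega$,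
  -- which is separating.
  refine norm_le_of_subrepresentation (A := localAlgebra (J : Set (Site ν)))
    (ρ := (fermionSubalgebra ν).subtype.comp (localAlgebra (J : Set (Site ν))).subtype)
    (V := localSpace (J : Set (Site ν))) (fun b f hf => apply_mem_localSpace b.2 hf)
    (fun b hb => Subtype.ext (ext_vacuum (hb _ hΩ)))
    (a := ⟨condExp J a, condExp_mem J a⟩) (norm_nonneg a) fun f hf => ?_
  obtain ⟨c, hc, rfl⟩ := mem_localSpace.mp hf
  change ‖evalVacuum ν (condExp J a * c)‖ ≤ ‖a‖ * ‖evalVacuum ν c‖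
  set d := condExp J a * c
  have hd : d ∈ localAlgebra (J : Set (Site ν)) := mul_mem (condExp_mem J a) hc
  -- With $d=E_J(a)c$, the trace property and $cd^*\in\mathcal A(J)$ give
  -- $\tau(d^*d)=\tau(E_J(a)cd^*)=\tau(acd^*)=\tau(d^*ac)$: the vector $d\Omega$ is the projection
  -- of $ac\Omega$.
  have h2 : ⟪evalVacuum ν d, evalVacuum ν d⟫_ℂ = ⟪evalVacuum ν d, evalVacuum ν (a * c)⟫_ℂ := by
    rw [evalVacuum_apply, evalVacuum_apply, ← tau_star_mul, ← tau_star_mul, tau_mul_comm,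
      tau_mul_comm _ (a * c), mul_assoc, mul_assoc,
      tau_condExp_mul J a (mul_mem hc (star_mem hd))]
  have h3 : ‖evalVacuum ν (a * c)‖ ≤ ‖a‖ * ‖evalVacuum ν c‖ :=
    (a : FermionSpace ν →L[ℂ] FermionSpace ν).le_opNorm _
  have h4 : ‖evalVacuum ν d‖ * ‖evalVacuum ν d‖ ≤
      ‖evalVacuum ν d‖ * (‖a‖ * ‖evalVacuum ν c‖) := by
    rw [← inner_self_eq_norm_mul_norm (𝕜 := ℂ), h2]
    refine (Complex.re_le_norm _).trans ?_
    exact (norm_inner_le_norm _ _).trans (by gcongr)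
  by_cases h0 : ‖evalVacuum ν d‖ = 0
  · rw [h0]; positivity
  · exact le_of_mul_le_mul_left h4 (lt_of_le_of_ne (norm_nonneg _) (Ne.symm h0))

theorem continuous_condExp (J : Finset (Site ν)) : Continuous (condExp J) :=
  AddMonoidHomClass.continuous_of_bound (condExp J) 1 fun a => by
    rw [one_mul]; exact norm_condExp_le J a

theorem mem_modes {J : Finset (Site ν)} {x : Mode ν} : x ∈ modes J ↔ ofLex (ofLex x).1 ∈ J := by
  unfold modes
  rw [Finset.mem_image]
  constructor
  · rintro ⟨p, hp, rfl⟩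
    exact (Finset.mem_product.mp hp).1
  · intro h
    exact ⟨(ofLex (ofLex x).1, (ofLex x).2), Finset.mem_product.mpr ⟨h, Finset.mem_univ _⟩, rfl⟩

theorem condExp_monomial (J : Finset (Site ν)) (S : Finset (Mode ν)) :
    condExp J (monomial S) = if S ⊆ modes J then monomial S else 0 := by
  rw [condExp_apply]
  simp_rw [tau_star_monomial_mul, ite_smul, one_smul, zero_smul]
  rw [Finset.sum_ite_eq']
  simp

/-- By linearity it suffices to test monomials supported in $K$; these are supported in $J$ exactly
when they are supported in $J\cap K$. -/
theorem condExp_eq_condExp_inter {J K : Finset (Site ν)} {a : FermionAlgebra ν}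
    (ha : a ∈ localAlgebra (K : Set (Site ν))) : condExp J a = condExp (J ∩ K) a := by
  refine LinearMap.eqOn_span (f := condExp J) (g := condExp (J ∩ K)) ?_ (mem_span_monomial ha)
  rintro _ ⟨S, hS, rfl⟩
  rw [Finset.mem_coe, Finset.mem_powerset] at hS
  rw [condExp_monomial, condExp_monomial]
  congr 1
  refine propext ⟨fun h x hx => ?_, fun h x hx => ?_⟩
  · exact mem_modes.mpr (Finset.mem_inter.mpr ⟨mem_modes.mp (h hx), mem_modes.mp (hS hx)⟩)
  · exact mem_modes.mpr (Finset.mem_inter.mp (mem_modes.mp (h hx))).1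

theorem condExp_of_mem {J : Finset (Site ν)} {a : FermionAlgebra ν}
    (ha : a ∈ localAlgebra (J : Set (Site ν))) : condExp J a = a :=
  (eq_condExp J ha fun _ _ => rfl).symm

theorem continuous_theta : Continuous (theta ν) := (StarAlgEquiv.isometry (theta ν)).continuous

theorem continuous_shift (k : Site ν) : Continuous (shift k) :=
  (StarAlgEquiv.isometry (shift k)).continuous

end LocalContraction

/-! ### Partial sums as conditional expectations -/

section PotentialEstimates

variable {ν : ℕ} {Φ Ψ : Finset (Site ν) → FermionAlgebra ν}

/-- If $K\not\subset J$, then $J\cap K$ is a proper subset of $K$. This extends the vanishing axiom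
from proper subsets of $K$ to arbitrary regions $J$. -/
theorem IsStandardPotential.condExp_apply (h : IsStandardPotential Φ) (J K : Finset (Site ν)) :
    condExp J (Φ K) = if K ⊆ J then Φ K else 0 := by
  rw [condExp_eq_condExp_inter (h.mem_localAlgebra K)]
  split_ifs with hK
  · rw [Finset.inter_eq_right.mpr hK, condExp_of_mem (h.mem_localAlgebra K)]
  · refine h.condExp_eq_zero K _ (Finset.inter_subset_right.ssubset_of_ne fun he => hK ?_)
    exact Finset.inter_eq_right.mp he

theorem IsStandardPotential.condExp_partialHamiltonian (h : IsStandardPotential Φ)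
    {I J L : Finset (Site ν)} (hJ : J ⊆ L) :
    condExp J (partialHamiltonian Φ I L) = partialHamiltonian Φ I J := by
  unfold partialHamiltonian
  rw [map_sum, Finset.sum_congr rfl fun K _ => h.condExp_apply J K, ← Finset.sum_filter]
  refine Finset.sum_congr ?_ fun _ _ => rfl
  ext K
  simp only [Finset.mem_filter, Finset.mem_powerset]
  exact ⟨fun H => ⟨H.2, H.1.2⟩, fun H => ⟨⟨H.1.trans hJ, H.2⟩, H.1⟩⟩

/-- The partial sums of a local Hamiltonian are its conditional expectations. -/
theorem IsStandardPotential.condExp_localHamiltonian (h : IsStandardPotential Φ)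
    (I J : Finset (Site ν)) : condExp J (localHamiltonian Φ I) = partialHamiltonian Φ I J := by
  have h1 := ((continuous_condExp J).tendsto _).comp (h.tendsto I)
  -- The net $L\mapsto E_J$ of the partial sum over $L$ is constant once $L\supseteq J$.
  refine tendsto_nhds_unique h1 (tendsto_const_nhds.congr' ?_)
  filter_upwards [eventually_ge_atTop J] with L hL
  exact (h.condExp_partialHamiltonian hL).symm

theorem IsStandardPotential.norm_partialHamiltonian_le (h : IsStandardPotential Φ)
    (I J : Finset (Site ν)) : ‖partialHamiltonian Φ I J‖ ≤ ‖localHamiltonian Φ I‖ := by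
  rw [← h.condExp_localHamiltonian]
  exact norm_condExp_le _ _

theorem localHamiltonian_add (h : IsStandardPotential Φ) (g : IsStandardPotential Ψ)
    (I : Finset (Site ν)) :
    localHamiltonian (Φ + Ψ) I = localHamiltonian Φ I + localHamiltonian Ψ I := by
  refine Tendsto.limUnder_eq ?_
  rw [partialHamiltonian_add]
  exact (h.tendsto I).add (g.tendsto I)

theorem localHamiltonian_smul (h : IsStandardPotential Φ) (c : ℝ) (I : Finset (Site ν)) :
    localHamiltonian (c • Φ) I = c • localHamiltonian Φ I := by
  refine Tendsto.limUnder_eq ?_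
  rw [partialHamiltonian_smul]
  exact (h.tendsto I).const_smul c

/-- A set meeting $I\cup\{n\}$ either meets $I$, or avoids $I$ and contains $n$; the latter sets are
the subsets of $J\setminus I$ containing $n$. -/
theorem partialHamiltonian_insert (Φ : Finset (Site ν) → FermionAlgebra ν) (n : Site ν)
    (I J : Finset (Site ν)) : partialHamiltonian Φ (insert n I) J =
      partialHamiltonian Φ I J + partialHamiltonian Φ {n} (J \ I) := by
  unfold partialHamiltonian
  rw [← Finset.sum_union]
  · refine Finset.sum_congr ?_ fun _ _ => rfl
    ext K
    simp only [Finset.mem_union, Finset.mem_filter, Finset.mem_powerset, Finset.subset_sdiff,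
      ← Finset.not_disjoint_iff_nonempty_inter, Finset.disjoint_insert_right,
      Finset.disjoint_singleton_right]
    tauto
  · rw [Finset.disjoint_left]
    intro K
    simp only [Finset.mem_filter, Finset.mem_powerset, Finset.subset_sdiff,
      ← Finset.not_disjoint_iff_nonempty_inter]
    tauto

theorem partialHamiltonian_empty (Φ : Finset (Site ν) → FermionAlgebra ν) (J : Finset (Site ν)) :
    partialHamiltonian Φ ∅ J = 0 := by
  simp [partialHamiltonian]

/-- Add the sites of $I$ one at a time. The region shrinks at each step, so the single-site bound
has to be uniform in the region. -/
theorem norm_partialHamiltonian_le_card (I J : Finset (Site ν)) {C : ℝ}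
    (hC : ∀ n J, ‖partialHamiltonian Φ {n} J‖ ≤ C) : ‖partialHamiltonian Φ I J‖ ≤ I.card * C := by
  induction I using Finset.induction_on with
  | empty => simp [partialHamiltonian_empty]
  | insert n I hn ih =>
    rw [partialHamiltonian_insert, Finset.card_insert_of_notMem hn]
    push_cast
    rw [add_mul, one_mul]
    exact (norm_add_le _ _).trans (add_le_add ih (hC _ _))

/-! ### Translations -/

theorem mem_translate {I : Finset (Site ν)} {k i : Site ν} : i ∈ translate I k ↔ i - k ∈ I := by
  unfold translate
  rw [Finset.mem_map_equiv]
  rfl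

theorem translate_translate (I : Finset (Site ν)) (k l : Site ν) :
    translate (translate I k) l = translate I (k + l) := by
  ext i; simp only [mem_translate, sub_sub, add_comm k l]

theorem translate_zero (I : Finset (Site ν)) : translate I 0 = I := by
  ext i; simp only [mem_translate, sub_zero]

theorem translate_subset_iff {I J : Finset (Site ν)} {k : Site ν} :
    translate I k ⊆ translate J k ↔ I ⊆ J := Finset.map_subset_map

/-- Translation as an order automorphism of the finite subsets of the lattice. -/
def translateIso (k : Site ν) : Finset (Site ν) ≃o Finset (Site ν) where
  toFun I := translate I k
  invFun I := translate I (-k)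
  left_inv I := by simp [translate_translate, translate_zero]
  right_inv I := by simp [translate_translate, translate_zero]
  map_rel_iff' := translate_subset_iff

theorem IsTranslationCovariant.partialHamiltonian_translate (h : IsTranslationCovariant Φ)
    (I J : Finset (Site ν)) (k : Site ν) :
    partialHamiltonian Φ (translate I k) (translate J k) = shift k (partialHamiltonian Φ I J) := by
  unfold partialHamiltonian
  rw [map_sum]
  refine (Finset.sum_equiv (translateIso k).toEquiv (fun K => ?_) fun K _ => h K k).symm
  change _ ↔ translate K k ∈ _
  simp only [Finset.mem_filter, Finset.mem_powerset, translate_subset_iff]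
  unfold translate
  rw [← Finset.map_inter, Finset.map_nonempty]

/-- Translation is an order automorphism of the finite regions, so reindexing the net by $J\mapsto
J+k$ does not change its limit. -/
theorem localHamiltonian_translate (h : IsStandardPotential Φ) (h' : IsTranslationCovariant Φ)
    (I : Finset (Site ν)) (k : Site ν) :
    localHamiltonian Φ (translate I k) = shift k (localHamiltonian Φ I) := by
  refine tendsto_nhds_unique ((h.tendsto _).comp (translateIso k).tendsto_atTop) ?_
  refine (((continuous_shift k).tendsto _).comp (h.tendsto I)).congr fun J => ?_
  exact (h'.partialHamiltonian_translate I J k).symm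

theorem norm_localHamiltonian_singleton (h : IsStandardPotential Φ)
    (h' : IsTranslationCovariant Φ) (n : Site ν) :
    ‖localHamiltonian Φ {n}‖ = ‖localHamiltonian Φ {0}‖ := by
  have : ({n} : Finset (Site ν)) = translate {0} n := by
    ext i; simp [mem_translate, sub_eq_zero]
  rw [this, localHamiltonian_translate h h']
  exact StarAlgEquiv.norm_map (shift n) _

/-- The value of a potential at `K` is controlled by the norm of the potential. -/
theorem exists_norm_apply_le (K : Finset (Site ν)) : ∃ C : ℝ, 0 ≤ C ∧
    ∀ Φ : Finset (Site ν) → FermionAlgebra ν, IsStandardPotential Φ → IsTranslationCovariant Φ →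
      ‖Φ K‖ ≤ C * ‖localHamiltonian Φ {0}‖ := by
  induction K using Finset.strongInduction with
  | H K ih =>
    rcases K.eq_empty_or_nonempty with rfl | ⟨n, hn⟩
    · exact ⟨0, le_rfl, fun Φ h _ => by simp [h.map_empty]⟩
    choose! C hC hb using ih
    -- The summand 1 pays for the partial sum at a site $n\in K$ over the region $K$; the constants
    -- $C_L$ pay for the proper subsets $L$ subtracted from it to isolate $\Phi(K)$.
    refine ⟨1 + ∑ L ∈ K.ssubsets, C L, add_nonneg zero_le_one
      (Finset.sum_nonneg fun L hL => hC L (Finset.mem_ssubsets.mp hL)), fun Φ h h' => ?_⟩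
    have h1 : partialHamiltonian Φ {n} K =
        Φ K + ∑ L ∈ K.ssubsets with (L ∩ {n}).Nonempty, Φ L := by
      unfold partialHamiltonian
      have h2 : ({L ∈ K.powerset | (L ∩ {n}).Nonempty} : Finset _) =
          insert K {L ∈ K.ssubsets | (L ∩ {n}).Nonempty} := by
        have hKn : (K ∩ {n}).Nonempty := ⟨n, by simp [hn]⟩
        ext L
        simp only [Finset.mem_filter, Finset.mem_powerset, Finset.mem_insert,
          Finset.mem_ssubsets]
        constructor
        · rintro ⟨h3, h4⟩
          exact h3.eq_or_ssubset.imp id fun h5 => ⟨h5, h4⟩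
        · rintro (rfl | h3)
          · exact ⟨subset_rfl, hKn⟩
          · exact ⟨h3.1.subset, h3.2⟩
      rw [h2, Finset.sum_insert (by simp)]
    rw [eq_sub_of_add_eq h1.symm, add_mul, one_mul]
    refine (norm_sub_le _ _).trans (add_le_add ?_ ?_)
    · rw [← norm_localHamiltonian_singleton h h' n]
      exact h.norm_partialHamiltonian_le _ _
    · refine (norm_sum_le _ _).trans ?_
      rw [Finset.sum_mul]
      refine (Finset.sum_le_sum fun L hL =>
        hb L (Finset.mem_ssubsets.mp (Finset.mem_filter.mp hL).1) Φ h h').trans ?_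
      refine Finset.sum_le_sum_of_subset_of_nonneg (Finset.filter_subset _ _) fun L hL _ => ?_
      exact mul_nonneg (hC L (Finset.mem_ssubsets.mp hL)) (norm_nonneg _)

end PotentialEstimates

/-! ### Norm, completeness and separability -/

section BanachSpace

variable {ν : ℕ}

theorem PotentialSpace.isStandardPotential (Φ : PotentialSpace ν) : IsStandardPotential Φ :=
  Φ.2.1

theorem PotentialSpace.isTranslationCovariant (Φ : PotentialSpace ν) : IsTranslationCovariant Φ :=
  Φ.2.2

/-- The linear map `Φ ↦ H_Φ({0})`. -/
def hamiltonianMap (ν : ℕ) : PotentialSpace ν →ₗ[ℝ] FermionAlgebra ν where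
  toFun Φ := localHamiltonian Φ {0}
  map_add' Φ Ψ := localHamiltonian_add Φ.isStandardPotential Ψ.isStandardPotential {0}
  map_smul' c Φ := localHamiltonian_smul Φ.isStandardPotential c {0}

theorem norm_hamiltonianMap (Φ : PotentialSpace ν) : ‖hamiltonianMap ν Φ‖ = ‖Φ‖ := rfl

theorem PotentialSpace.norm_partialHamiltonian_singleton_le (Φ : PotentialSpace ν) (n : Site ν)
    (J : Finset (Site ν)) : ‖partialHamiltonian Φ {n} J‖ ≤ ‖Φ‖ :=
  (Φ.isStandardPotential.norm_partialHamiltonian_le _ _).trans_eq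
    (norm_localHamiltonian_singleton Φ.isStandardPotential Φ.isTranslationCovariant n)

/-- The seminorm axioms are pulled back along the linear map `hamiltonianMap`; only definiteness
uses the structure of potentials, through `exists_norm_apply_le`. -/
theorem potentialSpaceCore (ν : ℕ) : NormedSpace.Core ℝ (PotentialSpace ν) where
  norm_nonneg Φ := norm_nonneg (hamiltonianMap ν Φ)
  norm_smul c Φ := by
    rw [← norm_hamiltonianMap, map_smul]
    exact norm_smul c (hamiltonianMap ν Φ)
  norm_triangle Φ Ψ := by
    rw [← norm_hamiltonianMap, map_add]
    exact norm_add_le _ _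
  norm_eq_zero_iff Φ := by
    constructor
    · intro h
      refine Subtype.ext (funext fun K => ?_)
      obtain ⟨C, -, hC⟩ := exists_norm_apply_le K
      have := hC Φ Φ.isStandardPotential Φ.isTranslationCovariant
      change _ ≤ C * ‖Φ‖ at this
      rw [h, mul_zero] at this
      exact norm_le_zero_iff.mp this
    · rintro rfl
      rw [← norm_hamiltonianMap, map_zero]
      exact norm_zero

instance : NormedAddCommGroup (PotentialSpace ν) := NormedAddCommGroup.ofCore (potentialSpaceCore ν)

theorem isometry_hamiltonianMap : Isometry (hamiltonianMap ν) :=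
  AddMonoidHomClass.isometry_of_norm _ norm_hamiltonianMap

theorem partialHamiltonian_sub (Φ Ψ : Finset (Site ν) → FermionAlgebra ν)
    (I J : Finset (Site ν)) :
    partialHamiltonian (Φ - Ψ) I J = partialHamiltonian Φ I J - partialHamiltonian Ψ I J := by
  simp [partialHamiltonian, Finset.sum_sub_distrib]

theorem tendsto_partialHamiltonian {u : ℕ → Finset (Site ν) → FermionAlgebra ν}
    {Φ : Finset (Site ν) → FermionAlgebra ν} (h : ∀ K, Tendsto (u · K) atTop (𝓝 (Φ K)))
    (I J : Finset (Site ν)) :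
    Tendsto (fun n => partialHamiltonian (u n) I J) atTop (𝓝 (partialHamiltonian Φ I J)) :=
  tendsto_finsetSum _ fun K _ => h K

/-- A pointwise limit of standard potentials is standard if the partial sums of the local
Hamiltonians converge uniformly. -/
theorem isStandardPotential_of_tendsto {u : ℕ → Finset (Site ν) → FermionAlgebra ν}
    {Φ : Finset (Site ν) → FermionAlgebra ν} (hu : ∀ n, IsStandardPotential (u n))
    (h : ∀ K, Tendsto (u · K) atTop (𝓝 (Φ K)))
    (hI : ∀ I, ∀ ε > 0, ∃ n, ∀ J, ‖partialHamiltonian (u n - Φ) I J‖ ≤ ε) :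
    IsStandardPotential Φ where
  mem_localAlgebra I := (localAlgebra_isClosed (I : Set (Site ν))).mem_of_tendsto (h I)
    (Eventually.of_forall fun n => (hu n).mem_localAlgebra I)
  map_empty := tendsto_nhds_unique (h ∅)
    (tendsto_const_nhds.congr fun n => (hu n).map_empty.symm)
  star_eq I := tendsto_nhds_unique
    (((continuous_star.tendsto _).comp (h I)).congr fun n => (hu n).star_eq I) (h I)
  theta_eq I := tendsto_nhds_unique
    (((continuous_theta.tendsto _).comp (h I)).congr fun n => (hu n).theta_eq I) (h I)
  condExp_eq_zero I J hJ := tendsto_nhds_unique (((continuous_condExp J).tendsto _).comp (h I))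
    (tendsto_const_nhds.congr fun n => ((hu n).condExp_eq_zero I J hJ).symm)
  cauchy I := by
    refine Metric.cauchySeq_iff.mpr fun ε hε => ?_
    -- A three-$\varepsilon$ argument: $n$ is fixed first, uniformly in the region, and only then is
    -- the Cauchy net of $u_n$ used.
    obtain ⟨n, hn⟩ := hI I (ε / 3) (by positivity)
    obtain ⟨N, hN⟩ := Metric.cauchySeq_iff.mp ((hu n).cauchy I) (ε / 3) (by positivity)
    refine ⟨N, fun J hJ L hL => ?_⟩
    have h1 : ∀ J, dist (partialHamiltonian Φ I J) (partialHamiltonian (u n) I J) ≤ ε / 3 := by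
      intro J
      rw [dist_comm, dist_eq_norm, ← partialHamiltonian_sub]
      exact hn J
    have h2 := h1 L
    rw [dist_comm] at h2
    linarith [h1 J, hN J hJ L hL, dist_triangle4 (partialHamiltonian Φ I J)
      (partialHamiltonian (u n) I J) (partialHamiltonian (u n) I L) (partialHamiltonian Φ I L)]

/-- The linear map `Φ ↦ Φ(K)`. -/
def evalMap (K : Finset (Site ν)) : PotentialSpace ν →ₗ[ℝ] FermionAlgebra ν where
  toFun Φ := Φ K
  map_add' _ _ := rfl
  map_smul' _ _ := rfl

theorem exists_norm_evalMap_le (K : Finset (Site ν)) :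
    ∃ C : ℝ, ∀ Φ : PotentialSpace ν, ‖evalMap K Φ‖ ≤ C * ‖Φ‖ := by
  obtain ⟨C, -, hb⟩ := exists_norm_apply_le K
  exact ⟨C, fun Φ => hb Φ Φ.isStandardPotential Φ.isTranslationCovariant⟩

theorem uniformContinuous_evalMap (K : Finset (Site ν)) : UniformContinuous (evalMap K) := by
  obtain ⟨C, hC⟩ := exists_norm_evalMap_le K
  exact (AddMonoidHomClass.lipschitz_of_bound _ C hC).uniformContinuous

theorem PotentialSpace.cauchySeq_apply {u : ℕ → PotentialSpace ν} (hu : CauchySeq u)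
    (K : Finset (Site ν)) : CauchySeq fun n => u n K :=
  (uniformContinuous_evalMap K).comp_cauchySeq hu

/-- The limit is taken pointwise. Since one norm bounds the partial sums at all sites and over all
regions, convergence of these sums is uniform (`key`), which yields both that the limit is standard
and that it is a limit in norm. -/
instance : CompleteSpace (PotentialSpace ν) := by
  refine Metric.complete_of_cauchySeq_tendsto fun u hu => ?_
  choose Φ hΦ using fun K => cauchySeq_tendsto_of_complete (PotentialSpace.cauchySeq_apply hu K)
  have key : ∀ ε > 0, ∃ N, ∀ n ≥ N, ∀ i J,
      ‖partialHamiltonian ((u n : Finset (Site ν) → FermionAlgebra ν) - Φ) {i} J‖ ≤ ε := by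
    intro ε hε
    obtain ⟨N, hN⟩ := Metric.cauchySeq_iff.mp hu ε hε
    refine ⟨N, fun n hn i J => ?_⟩
    -- Let $m\to\infty$ in the bound for $u_n-u_m$; for a fixed region the partial sum is finite, so
    -- pointwise convergence suffices.
    have h1 := tendsto_partialHamiltonian (u := fun m K => u n K - u m K)
      (fun K => (tendsto_const_nhds (x := u n K)).sub (hΦ K)) {i} J
    refine le_of_tendsto h1.norm ?_
    filter_upwards [eventually_ge_atTop N] with m hm
    refine ((u n - u m).norm_partialHamiltonian_singleton_le i J).trans ?_
    rw [← dist_eq_norm]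
    exact (hN n hn m hm).le
  have hst : IsStandardPotential Φ := by
    refine isStandardPotential_of_tendsto (fun n => (u n).isStandardPotential) hΦ fun I ε hε => ?_
    -- The bound for $I$ costs a factor $|I|$; adding 1 keeps the divisor positive when
    -- $I=\emptyset$.
    obtain ⟨N, hN⟩ := key (ε / (I.card + 1)) (by positivity)
    refine ⟨N, fun J => (norm_partialHamiltonian_le_card I J (hN N le_rfl)).trans ?_⟩
    rw [← mul_div_assoc, div_le_iff₀ (by positivity)]
    nlinarith
  have hcov : IsTranslationCovariant Φ := fun I k => tendsto_nhds_unique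
    (((continuous_shift k).tendsto _).comp (hΦ I))
    ((hΦ (translate I k)).congr fun n => ((u n).isTranslationCovariant I k).symm)
  let Ψ : PotentialSpace ν := ⟨Φ, hst, hcov⟩
  refine ⟨Ψ, Metric.tendsto_atTop.mpr fun ε hε => ?_⟩
  obtain ⟨N, hN⟩ := key (ε / 2) (by positivity)
  refine ⟨N, fun n hn => ?_⟩
  rw [dist_eq_norm]
  have h1 : ‖u n - Ψ‖ ≤ ε / 2 :=
    le_of_tendsto ((u n - Ψ).isStandardPotential.tendsto {0}).norm
      (Eventually.of_forall fun J => hN n hn 0 J)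
  linarith

/-- Each partial sum is a value of $E_J$, hence a finite combination of monomials. -/
theorem hamiltonianMap_mem_closure (Φ : PotentialSpace ν) : hamiltonianMap ν Φ ∈
    closure (Submodule.span ℂ (Set.range (monomial (ν := ν))) : Set (FermionAlgebra ν)) := by
  refine mem_closure_of_tendsto (Φ.isStandardPotential.tendsto {0})
    (Eventually.of_forall fun J => ?_)
  rw [← Φ.isStandardPotential.condExp_localHamiltonian]
  exact Submodule.sum_mem _ fun S _ =>
    Submodule.smul_mem _ _ (Submodule.subset_span ⟨S, rfl⟩)

/-- Countably many modes have countably many finite subsets, so the closed span of the monomials is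
separable, and separability pulls back along the isometry `hamiltonianMap`. -/
instance : TopologicalSpace.SeparableSpace (PotentialSpace ν) := by
  have hc : Countable (Mode ν) := inferInstanceAs (Countable (Site ν × Bool))
  have h1 : TopologicalSpace.IsSeparable (closure
      (Submodule.span ℂ (Set.range (monomial (ν := ν))) : Set (FermionAlgebra ν))) :=
    ((Set.countable_range _).isSeparable.span).closure
  have h2 := (isometry_hamiltonianMap (ν := ν)).isUniformInducing.isInducing.isSeparable_preimage h1
  rw [← TopologicalSpace.isSeparable_univ_iff]
  exact h2.mono fun Φ _ => hamiltonianMap_mem_closure Φ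

end BanachSpace

/-! ### Averaging over translates of a finite region -/

section FiniteRange

variable {ν : ℕ} {Φ : Finset (Site ν) → FermionAlgebra ν}

/-- The number of translates of `J` containing `K`, divided by the size of `J`. -/
def translateWeight (J K : Finset (Site ν)) : ℝ := {k | K ⊆ translate J k}.ncard / J.card

theorem translateWeight_translate (J K : Finset (Site ν)) (l : Site ν) :
    translateWeight J (translate K l) = translateWeight J K := by
  have h : {k | translate K l ⊆ translate J k} = (· + l) '' {k | K ⊆ translate J k} := by
    ext k
    simp only [Set.image_add_right, Set.mem_preimage]
    change _ ↔ K ⊆ translate J (k + -l)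
    rw [← translate_subset_iff (k := l), translate_translate, neg_add_cancel_right]
    rfl
  rw [translateWeight, h, Set.ncard_image_of_injective _ (add_left_injective l), translateWeight]

/-- The image of a potential under averaging over the translates of the finite region `J`. -/
def localAverage (J : Finset (Site ν)) (Φ : Finset (Site ν) → FermionAlgebra ν) :
    Finset (Site ν) → FermionAlgebra ν := fun K => translateWeight J K • Φ K

/-- Exchange the sums over $K$ and $k$: each $K$ is counted once for every translate of $J$
containing it. Translates outside $F$ miss $I$, so they contain no $K$ that meets $I$. -/
theorem partialHamiltonian_localAverage {J I F : Finset (Site ν)}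
    (hF : ∀ k, (translate J k ∩ I).Nonempty → k ∈ F) (L : Finset (Site ν)) :
    partialHamiltonian (localAverage J Φ) I L =
      (J.card : ℝ)⁻¹ • ∑ k ∈ F, partialHamiltonian Φ I (L ∩ translate J k) := by
  classical
  have h1 : ∀ k, partialHamiltonian Φ I (L ∩ translate J k) =
      ∑ K ∈ L.powerset with (K ∩ I).Nonempty, if K ⊆ translate J k then Φ K else 0 := by
    intro k
    rw [← Finset.sum_filter]
    refine Finset.sum_congr ?_ fun _ _ => rfl
    ext K
    simp only [Finset.mem_filter, Finset.mem_powerset, Finset.subset_inter_iff]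
    tauto
  rw [Finset.sum_congr rfl fun k _ => h1 k, Finset.sum_comm, Finset.smul_sum]
  refine Finset.sum_congr rfl fun K hK => ?_
  -- As $K$ meets $I$, every translate containing $K$ meets $I$ too. So the set is finite and its
  -- `ncard` is a genuine count.
  have h2 : {k | K ⊆ translate J k} = ((F.filter fun k => K ⊆ translate J k : Finset _) : Set _) := by
    ext k
    simp only [Finset.coe_filter, Set.mem_ofPred_eq]
    refine ⟨fun h => ⟨hF k ?_, h⟩, fun h => h.2⟩
    exact (Finset.mem_filter.mp hK).2.mono (Finset.inter_subset_inter_right h)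
  rw [← Finset.sum_filter, Finset.sum_const, localAverage, translateWeight, h2,
    Set.ncard_coe_finset, div_eq_inv_mul, mul_smul, Nat.cast_smul_eq_nsmul]

/-- The net is constant once $L$ contains the finitely many translates $J+k$, $k\in F$; in
particular it is Cauchy. -/
theorem tendsto_partialHamiltonian_localAverage {J I F : Finset (Site ν)}
    (hF : ∀ k, (translate J k ∩ I).Nonempty → k ∈ F) :
    Tendsto (partialHamiltonian (localAverage J Φ) I) atTop
      (𝓝 ((J.card : ℝ)⁻¹ • ∑ k ∈ F, partialHamiltonian Φ I (translate J k))) := by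
  refine tendsto_const_nhds.congr' ?_
  filter_upwards [eventually_ge_atTop (F.biUnion (translate J))] with L hL
  rw [partialHamiltonian_localAverage hF]
  congr 1
  refine Finset.sum_congr rfl fun k hk => ?_
  rw [Finset.inter_eq_right.mpr ((Finset.subset_biUnion_of_mem (translate J) hk).trans hL)]

theorem IsStandardPotential.localAverage (h : IsStandardPotential Φ) (J : Finset (Site ν)) :
    IsStandardPotential (localAverage J Φ) where
  mem_localAlgebra I := SMulMemClass.smul_mem (translateWeight J I : ℂ) (h.mem_localAlgebra I)
  -- The weight of $\emptyset$ plays no role here, even where infinitely many translates make its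
  -- `ncard` the default 0: already $\Phi(\emptyset)=0$.
  map_empty := by rw [FermionLattice.localAverage, h.map_empty, smul_zero]
  star_eq I := by
    change star ((translateWeight J I : ℂ) • Φ I) = (translateWeight J I : ℂ) • Φ I
    rw [star_smul, h.star_eq]
    simp
  theta_eq I := by
    change theta ν ((translateWeight J I : ℂ) • Φ I) = (translateWeight J I : ℂ) • Φ I
    rw [map_smul, h.theta_eq]
  condExp_eq_zero I L hL := by
    change condExp L ((translateWeight J I : ℂ) • Φ I) = 0
    rw [map_smul, h.condExp_eq_zero I L hL, smul_zero]
  cauchy I := by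
    -- If $i\in(J+k)\cap I$, then $k=i-(i-k)$ with $i-k\in J$, so the differences $I-J$ contain all
    -- relevant $k$.
    refine (tendsto_partialHamiltonian_localAverage (Φ := Φ) (J := J) (I := I)
      (F := (I ×ˢ J).image fun p => p.1 - p.2) fun k => ?_).cauchySeq
    rintro ⟨i, hi⟩
    rw [Finset.mem_inter, mem_translate] at hi
    exact Finset.mem_image.mpr ⟨(i, i - k), Finset.mem_product.mpr ⟨hi.2, hi.1⟩,
      sub_sub_cancel i k⟩

theorem IsTranslationCovariant.localAverage (h : IsTranslationCovariant Φ)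
    (J : Finset (Site ν)) : IsTranslationCovariant (localAverage J Φ) := by
  intro I k
  change shift k ((translateWeight J I : ℂ) • Φ I) =
    (translateWeight J (translate I k) : ℂ) • Φ (translate I k)
  rw [map_smul, h, translateWeight_translate]

theorem siteDiam_mono {I J : Finset (Site ν)} (h : I ⊆ J) : siteDiam I ≤ siteDiam J :=
  Metric.diam_mono (Set.image_mono (Finset.coe_subset.mpr h))
    (J.finite_toSet.image _).isBounded

theorem siteDiam_translate (J : Finset (Site ν)) (k : Site ν) :
    siteDiam (translate J k) = siteDiam J := by
  unfold siteDiam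
  set f := fun i : Site ν => (WithLp.toLp 2 fun t => (i t : ℝ) : EuclideanSpace ℝ (Fin ν))
  have h : f '' (translate J k : Set (Site ν)) = IsometryEquiv.addRight (f k) '' (f '' J) := by
    unfold translate
    rw [Finset.coe_map, Set.image_image, Set.image_image]
    refine Set.image_congr fun i _ => ?_
    ext t
    simp [f]
  rw [h, (IsometryEquiv.addRight (f k)).isometry.diam_image]

/-- A set of diameter larger than that of $J$ fits into no translate of $J$, so its weight is 0. -/
theorem isFiniteRange_localAverage (J : Finset (Site ν))
    (Φ : Finset (Site ν) → FermionAlgebra ν) : IsFiniteRange (localAverage J Φ) := by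
  refine ⟨siteDiam J, Metric.diam_nonneg, fun I hI => ?_⟩
  have h : {k | I ⊆ translate J k} = ∅ := by
    refine Set.eq_empty_of_forall_notMem fun k hk => hI.not_ge ?_
    rw [← siteDiam_translate J k]
    exact siteDiam_mono hk
  rw [localAverage, translateWeight, h, Set.ncard_empty]
  simp

/-! ### Large cubes and density of the finite-range potentials -/

/-- The cube `[-N, N]^ν`. -/
def cube (ν N : ℕ) : Finset (Site ν) := Finset.Icc (fun _ => -(N : ℤ)) (fun _ => (N : ℤ))

theorem mem_cube {N : ℕ} {i : Site ν} : i ∈ cube ν N ↔ ∀ t, |i t| ≤ N := by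
  simp only [cube, Finset.mem_Icc, Pi.le_def, abs_le]
  exact forall_and.symm

theorem card_cube (ν N : ℕ) : (cube ν N).card = (2 * N + 1) ^ ν := by
  rw [cube, Pi.card_Icc]
  simp only [Int.card_Icc, Finset.prod_const, Finset.card_univ, Fintype.card_fin]
  congr 1
  omega

theorem exists_subset_cube (I : Finset (Site ν)) : ∃ N, I ⊆ cube ν N := by
  refine ⟨I.sup fun i => Finset.univ.sup fun t => (i t).natAbs, fun i hi => mem_cube.mpr fun t => ?_⟩
  have h1 : (i t).natAbs ≤ Finset.univ.sup fun t => (i t).natAbs :=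
    Finset.le_sup (f := fun t => (i t).natAbs) (Finset.mem_univ t)
  have h2 := Finset.le_sup (f := fun i : Site ν => Finset.univ.sup fun t => (i t).natAbs) hi
  have h3 := h1.trans h2
  rw [Int.abs_eq_natAbs]
  exact_mod_cast h3

theorem cube_subset_translate (M n : ℕ) {k : Site ν} (hk : k ∈ cube ν n) :
    cube ν M ⊆ translate (cube ν (M + n)) k := by
  intro i hi
  rw [mem_translate, mem_cube]
  intro t
  have h1 := mem_cube.mp hi t
  have h2 := mem_cube.mp hk t
  push_cast
  exact (abs_sub _ _).trans (add_le_add h1 h2)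

/-- The van Hove property of cubes: the boundary layer of fixed width $M$ has vanishing proportion,
the ratio being $(1-2M/(2(M+n)+1))^\nu$. -/
theorem tendsto_card_cube_ratio (ν M : ℕ) : Tendsto
    (fun n : ℕ => ((cube ν n).card : ℝ) / (cube ν (M + n)).card) atTop (𝓝 1) := by
  have h1 : Tendsto (fun n : ℕ => (2 * (M + n : ℕ) + 1 : ℝ)) atTop atTop := by
    refine tendsto_atTop_mono (fun n => ?_) tendsto_natCast_atTop_atTop
    have := Nat.cast_nonneg (α := ℝ) n
    push_cast
    linarith [Nat.cast_nonneg (α := ℝ) M]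
  have h2 : Tendsto (fun n : ℕ => (1 - 2 * M / (2 * (M + n : ℕ) + 1 : ℝ)) ^ ν) atTop (𝓝 1) := by
    simpa using ((h1.const_div_atTop (2 * M : ℝ)).const_sub 1).pow ν
  refine h2.congr fun n => ?_
  rw [card_cube, card_cube]
  push_cast
  rw [← div_pow]
  congr 1
  field_simp
  ring

/-- Split the average into the good indices $G$, with error $\varepsilon$, and the remaining
fraction $1-|G|/|F|$, with error $C$. -/
theorem norm_average_sub_le {E ι : Type*} [NormedAddCommGroup E] [NormedSpace ℝ E]
    [DecidableEq ι] {F G : Finset ι} (hG : G ⊆ F) (hF : F.Nonempty) (f : ι → E) (h : E)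
    {ε C : ℝ} (h1 : ∀ k ∈ G, ‖f k - h‖ ≤ ε) (h2 : ∀ k ∈ F, ‖f k - h‖ ≤ C) (hε : 0 ≤ ε) :
    ‖(F.card : ℝ)⁻¹ • ∑ k ∈ F, f k - h‖ ≤ ε + (1 - (G.card : ℝ) / F.card) * C := by
  have hc : (0 : ℝ) < F.card := by exact_mod_cast hF.card_pos
  have e1 : (F.card : ℝ)⁻¹ • ∑ k ∈ F, f k - h = (F.card : ℝ)⁻¹ • ∑ k ∈ F, (f k - h) := by
    rw [Finset.sum_sub_distrib, smul_sub, Finset.sum_const, ← Nat.cast_smul_eq_nsmul ℝ,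
      smul_smul, inv_mul_cancel₀ hc.ne', one_smul]
  have e2 : ‖∑ k ∈ F, (f k - h)‖ ≤ (F.card - G.card : ℝ) * C + G.card * ε := by
    rw [← Finset.sum_sdiff hG]
    refine (norm_add_le _ _).trans (add_le_add ?_ ?_)
    · refine (norm_sum_le_of_le _ fun k hk => h2 k (Finset.sdiff_subset hk)).trans_eq ?_
      rw [Finset.sum_const, nsmul_eq_mul, Finset.card_sdiff_of_subset hG,
        Nat.cast_sub (Finset.card_le_card hG)]
    · refine (norm_sum_le_of_le _ h1).trans_eq ?_
      rw [Finset.sum_const, nsmul_eq_mul]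
  have e3 : (G.card : ℝ) ≤ F.card := by exact_mod_cast Finset.card_le_card hG
  rw [e1, norm_smul, norm_inv, Real.norm_of_nonneg hc.le, inv_mul_le_iff₀ hc]
  refine e2.trans ?_
  have e4 : F.card * (ε + (1 - (G.card : ℝ) / F.card) * C) =
      F.card * ε + (F.card - G.card) * C := by field_simp
  rw [e4, add_comm]
  gcongr

/-- The approximant is the average of $\Phi$ over translates of $J=[-(M+n),M+n]^\nu$. For
$k\in[-n,n]^\nu$ the translate $J+k$ contains $[-M,M]^\nu$, where the partial sum is already within
$\varepsilon/2$ of $H_\Phi(\{0\})$; the other $k\in J$ are few when $n$ is large. -/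
theorem dense_finiteRangeSubmodule :
    Dense (finiteRangeSubmodule ν : Set (PotentialSpace ν)) := by
  refine Metric.dense_iff.mpr fun Φ ε hε => ?_
  set h := localHamiltonian Φ {0}
  obtain ⟨L, hL⟩ := Metric.tendsto_atTop.mp (Φ.isStandardPotential.tendsto {0}) (ε / 2)
    (by positivity)
  obtain ⟨M, hM⟩ := exists_subset_cube L
  have hlim : Tendsto (fun n : ℕ => ε / 2 +
      (1 - ((cube ν n).card : ℝ) / (cube ν (M + n)).card) * (2 * ‖h‖)) atTop (𝓝 (ε / 2)) := by
    simpa using (((tendsto_card_cube_ratio ν M).const_sub 1).mul_const (2 * ‖h‖)).const_add (ε / 2)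
  obtain ⟨n, hn⟩ := (hlim.eventually_lt_const (half_lt_self hε)).exists
  set J := cube ν (M + n) with hJ
  let Ψ : PotentialSpace ν := ⟨localAverage J Φ, Φ.isStandardPotential.localAverage J,
    Φ.isTranslationCovariant.localAverage J⟩
  refine ⟨Ψ, ?_, isFiniteRange_localAverage J Φ⟩
  -- $0\in J+k$ means $-k\in J$, and the cube is symmetric; hence $J$ itself can index the
  -- translates.
  have hF : ∀ k, (translate J k ∩ {0}).Nonempty → k ∈ J := by
    rintro k ⟨i, hi⟩
    rw [Finset.mem_inter, mem_translate, Finset.mem_singleton] at hi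
    obtain ⟨hi, rfl⟩ := hi
    rw [hJ, mem_cube] at hi ⊢
    simpa using hi
  have hΨ : hamiltonianMap ν Ψ =
      (J.card : ℝ)⁻¹ • ∑ k ∈ J, partialHamiltonian Φ {0} (translate J k) :=
    tendsto_nhds_unique (Ψ.isStandardPotential.tendsto {0})
      (tendsto_partialHamiltonian_localAverage hF)
  rw [Metric.mem_ball, dist_eq_norm, ← norm_hamiltonianMap, map_sub, hΨ]
  refine (norm_average_sub_le (G := cube ν n) (ε := ε / 2) (C := 2 * ‖h‖) ?_ ?_ _ h ?_ ?_
    (by positivity)).trans_lt hn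
  · intro i hi
    rw [hJ, mem_cube]
    intro t
    have := mem_cube.mp hi t
    push_cast
    omega
  · exact ⟨0, mem_cube.mpr fun t => by simp; positivity⟩
  · intro k hk
    rw [← dist_eq_norm]
    exact (hL _ (hM.trans (cube_subset_translate M n hk))).le
  · intro k _
    -- For the remaining translates, contractivity of $E_{J+k}$ bounds the partial sum by $\|h\|$.
    rw [two_mul]
    exact (norm_sub_le _ _).trans (add_le_add
      (Φ.isStandardPotential.norm_partialHamiltonian_le _ _) le_rfl)

end FiniteRange

end

end FermionLattice

/-- The space of translation covariant standard potentials of the Fermion lattice system on `ℤ^ν`,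
with `‖Φ‖ = ‖H({n})‖` (for any site `n`), is a real normed space; it is complete, the finite range
potentials are dense in it, and it is separable. -/
theorem mainTheorem9 (ν : ℕ) (hν : 0 < ν) :
    (∀ (Φ : FermionLattice.PotentialSpace ν) (n : FermionLattice.Site ν),
      ‖FermionLattice.localHamiltonian Φ {n}‖ = ‖Φ‖) ∧
    ∃ core : NormedSpace.Core ℝ (FermionLattice.PotentialSpace ν),
      letI : NormedAddCommGroup (FermionLattice.PotentialSpace ν) :=
        NormedAddCommGroup.ofCore core
      CompleteSpace (FermionLattice.PotentialSpace ν) ∧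
      Dense (FermionLattice.finiteRangeSubmodule ν : Set (FermionLattice.PotentialSpace ν)) ∧
      TopologicalSpace.SeparableSpace (FermionLattice.PotentialSpace ν) := by
  refine ⟨fun Φ n => FermionLattice.norm_localHamiltonian_singleton Φ.isStandardPotential
    Φ.isTranslationCovariant n, FermionLattice.potentialSpaceCore ν, ?_⟩
  -- The global normed group instance was built from this same core, so its completeness, density
  -- and separability apply as they stand.
  exact ⟨inferInstance, FermionLattice.dense_finiteRangeSubmodule, inferInstance⟩
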